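/- Let $T>0$, $\frac13<\gamma\le 1$, $d,l\in\mathbb N$, and let $g=(g^{(1)},\dots,g^{(l)})\in C^3_b(\mathbb R^d;\mathbb R^{d,l})$, i.e. each column $g^{(i)}:\mathbb R^d\to\mathbb R^d$ is three times continuously differentiable and is bounded together with its derivatives up to order three. Write $\mathcal D^{(i)}g^{(j)}=\sum_{p=1}^d g^{(i)}_p\,\partial_p g^{(j)}$. For a continuous path $x:[0,T]\to\mathbb R^l$ that is differentiable outside a finite set of points, with $\int_0^T|\dot x_u|\,du<\infty$, put $$M^x_{st}=\Big|\int_s^t|\dot x_u|\,du\Big|^3,\qquad \mathbf x^{\mathbf 2}_{st}(i,j)=\int_s^t\big(x^{(i)}_u-x^{(i)}_s\big)\,\dot x^{(j)}_u\,du\qquad(0\le s\le t\le T),$$ $$\|\mathbf x\|_\gamma=\sup_{0\le s<t\le T}\frac{|x_t-x_s|}{|t-s|^{\gamma}}+\sup_{0\le s<t\le T}\frac{|\mathbf x^{\mathbf 2}_{st}|}{|t-s|^{2\gamma}},$$ where $|\cdot|$ is the Euclidean norm of vectors and matrices. There exists an increasing function $\tilde C_T:\mathbb R\to(0,\infty)$,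 depending only on $T,\gamma,g$ (and hence on $d,l$), such that the following holds for every such path $x$ with $\|\mathbf x\|_\gamma<\infty$. (The requirements $\int_0^T|\dot x_u|\,du<\infty$ and $\|\mathbf x\|_\gamma<\infty$ hold automatically if $x$ is piecewise $C^1$, in particular if $x$ is piecewise linear.) For all $s\in[0,T]$ and $z\in\mathbb R^d$ the equation $$y_t=z+\sum_{i=1}^l\int_s^t g^{(i)}(y_u)\,\dot x^{(i)}_u\,du,\qquad t\in[s,T],$$ has a unique continuous solution $y$ on $[s,T]$; write $\Phi(z;s,t)=y_t$. Let $a\in\mathbb R^d$, $n\ge1$, $t_k=kT/n$ and $y_{t_k}=\Phi(a;0,t_k)$ for $k=0,\dots,n$, and let $z^n$ be the second-order Taylor scheme $z^n_0=a$, $$z^n_{k+1}=z^n_k+\sum_{i=1}^l g^{(i)}(z^n_k)\big(x^{(i)}_{t_{k+1}}-x^{(i)}_{t_k}\big)+\sum_{i,j=1}^l\mathcal D^{(i)}g^{(j)}(z^n_k)\,\mathbf x^{\mathbf 2}_{t_kt_{k+1}}(i,j),\qquad 0\le k<n.$$ Then, for all $0\le p<q\le n$, $$|y_{t_q}-z^n_q|\le\tilde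 C_T(\|\mathbf x\|_\gamma)\sum_{k=0}^{q-1}M^x_{t_kt_{k+1}},$$ $$\big|(y_{t_q}-z^n_q)-(y_{t_p}-z^n_p)\big|\le\tilde C_T(\|\mathbf x\|_\gamma)\Big\{\sum_{k=p}^{q-1}M^x_{t_kt_{k+1}}+|t_q-t_p|^{\gamma}\sum_{k=0}^{p-1}M^x_{t_kt_{k+1}}\Big\}.$$ -/

import Mathlib

open Set MeasureTheory

noncomputable section

namespace TaylorODE

/-- `ℝ^m` with its Euclidean norm. -/
abbrev E (m : ℕ) : Type := EuclideanSpace ℝ (Fin m)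

/-- `f ∈ C³_b`: `f` is three times continuously differentiable, and `f` and its derivatives up to
order three are bounded. -/
def IsC3b {d : ℕ} (f : E d → E d) : Prop :=
  ContDiff ℝ 3 f ∧ ∀ k : ℕ, k ≤ 3 → ∃ K : ℝ, ∀ z, ‖iteratedFDeriv ℝ k f z‖ ≤ K

/-- `x` is a continuous path on `[0,T]`, differentiable outside finitely many points, and its
derivative is integrable over `[0,T]`. Values of `x` outside `[0,T]` play no role. -/
structure IsPiecewiseDifferentiable {l : ℕ} (T : ℝ) (x : ℝ → E l) : Prop where
  continuousOn : ContinuousOn x (Icc 0 T)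
  differentiableAt : ∃ F : Finset ℝ, ∀ t ∈ Ioo 0 T, t ∉ F → DifferentiableAt ℝ x t
  integrable_deriv : IntervalIntegrable (deriv x) volume 0 T

/-- The iterated integral `∫_s^t (x^{(i)}_u - x^{(i)}_s) dx^{(j)}_u`. -/
def iteratedIntegral {l : ℕ} (x : ℝ → E l) (i j : Fin l) (s t : ℝ) : ℝ :=
  ∫ u in s..t, (x u i - x s i) * deriv x u j

/-- The Euclidean (Frobenius) norm of the matrix of iterated integrals of `x` over `[s,t]`. -/
def areaNorm {l : ℕ} (x : ℝ → E l) (s t : ℝ) : ℝ :=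
  Real.sqrt (∑ i, ∑ j, iteratedIntegral x i j s t ^ 2)

/-- The Hölder quotients `f s t / |t - s| ^ μ` for `0 ≤ s < t ≤ T`, where `f s t` is the size of
an increment. -/
def holderQuotients (T μ : ℝ) (f : ℝ → ℝ → ℝ) : Set ℝ :=
  {c | ∃ s t : ℝ, 0 ≤ s ∧ s < t ∧ t ≤ T ∧ c = f s t / |t - s| ^ μ}

/-- `‖x‖_γ + ‖x²‖_{2γ}`, meaningful when both sets of Hölder quotients are bounded
(see `HasFiniteRoughNorm`). -/
def roughNorm {l : ℕ} (T γ : ℝ) (x : ℝ → E l) : ℝ :=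
  sSup (holderQuotients T γ fun s t => ‖x t - x s‖) +
    sSup (holderQuotients T (2 * γ) fun s t => areaNorm x s t)

/-- `‖x‖_γ < ∞` and `‖x²‖_{2γ} < ∞`. -/
def HasFiniteRoughNorm {l : ℕ} (T γ : ℝ) (x : ℝ → E l) : Prop :=
  BddAbove (holderQuotients T γ fun s t => ‖x t - x s‖) ∧
    BddAbove (holderQuotients T (2 * γ) fun s t => areaNorm x s t)

/-- `y` solves `dy_t = ∑ i, g^{(i)}(y_t) dx^{(i)}_t` on `[s,T]` with `y_s = z`. -/
def IsSolution {d l : ℕ} (g : Fin l → E d → E d) (x : ℝ → E l) (T s : ℝ) (z : E d)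
    (y : ℝ → E d) : Prop :=
  ContinuousOn y (Icc s T) ∧
    ∀ t ∈ Icc s T, y t = z + ∑ i, ∫ u in s..t, deriv x u i • g i (y u)

open Classical in
/-- The flow `Φ(z;s,t) = y_t`, where `y` is the solution on `[s,T]` with `y_s = z`. -/
def flow {d l : ℕ} (g : Fin l → E d → E d) (x : ℝ → E l) (T : ℝ) (z : E d) (s t : ℝ) : E d :=
  if h : ∃ y, IsSolution g x T s z y then h.choose t else z

/-- The function `𝒟^{(i)} g^{(j)} = ∑ p, g^{(i)}_p ∂_p g^{(j)}`, the derivative of `g^{(j)}` in the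
direction `g^{(i)}`. -/
def dirDeriv {d l : ℕ} (g : Fin l → E d → E d) (i j : Fin l) (z : E d) : E d :=
  fderiv ℝ (g j) z (g i z)

/-- One step `Ψ(z;s,t)` of the second order Taylor scheme. -/
def taylorStep {d l : ℕ} (g : Fin l → E d → E d) (x : ℝ → E l) (z : E d) (s t : ℝ) : E d :=
  z + ∑ i, (x t i - x s i) • g i z +
    ∑ i, ∑ j, iteratedIntegral x i j s t • dirDeriv g i j z

/-- The grid point `t_k = kT/n`. -/
def gridPoint (T : ℝ) (n k : ℕ) : ℝ := k * T / n

/-- The second order Taylor scheme `z^n_k = Ψ(a;0,t_k)` with step size `T/n`, the composition of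
the first `k` steps. -/
def taylorScheme {d l : ℕ} (g : Fin l → E d → E d) (x : ℝ → E l) (T : ℝ) (n : ℕ) (a : E d) :
    ℕ → E d
  | 0 => a
  | k + 1 => taylorStep g x (taylorScheme g x T n a k) (gridPoint T n k) (gridPoint T n (k + 1))

/-- The global error `y_{t_k} - z^n_k` at the grid point `t_k`, where `y_{t_k} = Φ(a;0,t_k)`. -/
def gridError {d l : ℕ} (g : Fin l → E d → E d) (x : ℝ → E l) (T : ℝ) (n : ℕ) (a : E d)
    (k : ℕ) : E d :=
  flow g x T a 0 (gridPoint T n k) - taylorScheme g x T n a k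

/-- `M_{st} = |∫_s^t |ẋ_u| du|³`. -/
def M {l : ℕ} (x : ℝ → E l) (s t : ℝ) : ℝ := |∫ u in s..t, ‖deriv x u‖| ^ 3

end TaylorODE

end

/-!
The solution flow `Φ` of the equation and the Taylor step `Ψ` differ over `[s, t]` by `O(M_{st})`;
this is an elementary Taylor expansion (`IsSolution.norm_localError_le`). The global error is a
telescoping sum of such local errors, each transported by the flow, so everything rests on a bound
for the Lipschitz constants of `Φ(·; s, t)` and of `Φ(·; s, t) - id`, the latter of order
`|t - s| ^ γ`, that involves the driving path only through its rough norm
(`exists_norm_solution_sub_le`). This is where `γ > 1/3` and three derivatives of `g` are used.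

By Chen's relation, the defect `Ψ_{ut} ∘ Ψ_{su} - Ψ_{st}` is of order `|t - s| ^ (3 γ)`, as a bounded
Lipschitz function of the starting point (`exists_bddLip_pathIncr_defect`). Hence the local error
`y_t - Ψ(y_s; s, t)` along a solution is almost additive under subdivision of the interval, up to an
error of order `3 γ > 1`. Since it is also `O(M_{st})`, with a bad constant but negligible on tiny
intervals, the sewing estimate `exists_sewing_bound` shows that it is of order `3 γ` with a uniform
constant (`exists_localError_le`). The same argument, applied to the difference of the local errors
along two solutions, gives the Lipschitz bounds on short intervals
(`exists_norm_solution_sub_le_local`), and these chain together to `[0, T]`.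

Since `ẋ` is only integrable, existence and uniqueness of solutions come from a contraction in a
supremum norm weighted by the arc length of the path (`exists_unique_isSolution`).
-/

namespace TaylorODE

section FunctionClasses

variable {V F G : Type*} [NormedAddCommGroup V] [NormedAddCommGroup F] [NormedAddCommGroup G]

/-! ### Bounded Lipschitz functions and second differences -/

/-- `f` is bounded by `K` and `K`-Lipschitz. -/
structure BddLip (f : V → F) (K : ℝ) : Prop where
  bound : ∀ z, ‖f z‖ ≤ K
  lip : ∀ z z', ‖f z - f z'‖ ≤ K * ‖z - z'‖

/-- `f` is bounded by `K` and `K`-Lipschitz, and so is every first difference `f (· + v) - f`, with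
Lipschitz constant `K * ‖v‖`. This is what is left of `f ∈ C²_b` when no derivative is mentioned. -/
structure BddLip2 (f : V → F) (K : ℝ) : Prop extends BddLip f K where
  lip2 : ∀ z z' v, ‖(f (z + v) - f z) - (f (z' + v) - f z')‖ ≤ K * ‖v‖ * ‖z - z'‖

namespace BddLip

theorem nonneg {f : V → F} {K : ℝ} (h : BddLip f K) : 0 ≤ K := (norm_nonneg _).trans (h.bound 0)

theorem mono {f : V → F} {K L : ℝ} (h : BddLip f K) (hKL : K ≤ L) : BddLip f L :=
  ⟨fun z => (h.bound z).trans hKL, fun z z' => (h.lip z z').trans (by gcongr)⟩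

theorem add {f f' : V → F} {K L : ℝ} (h : BddLip f K) (h' : BddLip f' L) :
    BddLip (fun z => f z + f' z) (K + L) where
  bound z := (norm_add_le _ _).trans (add_le_add (h.bound z) (h'.bound z))
  lip z z' := by
    rw [add_sub_add_comm, add_mul]
    exact (norm_add_le _ _).trans (add_le_add (h.lip z z') (h'.lip z z'))

theorem sum {ι : Type*} (s : Finset ι) {f : ι → V → F} {K : ℝ} (h : ∀ i, BddLip (f i) K) :
    BddLip (fun z => ∑ i ∈ s, f i z) (s.card * K) where
  bound z := by
    rw [← nsmul_eq_mul]
    exact norm_sum_le_of_le s (fun i _ => (h i).bound z) |>.trans (by simp)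
  lip z z' := by
    rw [← Finset.sum_sub_distrib, mul_assoc, ← nsmul_eq_mul]
    exact norm_sum_le_of_le s (fun i _ => (h i).lip z z') |>.trans (by simp)

variable [NormedSpace ℝ F] [NormedSpace ℝ G]

theorem smul {f : V → F} {K : ℝ} (h : BddLip f K) {c B : ℝ} (hc : |c| ≤ B) :
    BddLip (fun z => c • f z) (B * K) where
  bound z := by
    rw [norm_smul]
    exact mul_le_mul hc (h.bound z) (norm_nonneg _) ((abs_nonneg _).trans hc)
  lip z z' := by
    rw [← smul_sub, norm_smul, mul_assoc]
    exact mul_le_mul hc (h.lip z z') (norm_nonneg _) ((abs_nonneg _).trans hc)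

/-- The evaluation of a bounded Lipschitz family of operators along a bounded Lipschitz function. -/
theorem clm_apply {φ : V → F →L[ℝ] G} {f : V → F} {K L : ℝ} (hφ : BddLip φ K) (hf : BddLip f L) :
    BddLip (fun z => φ z (f z)) (2 * (K * L)) where
  bound z := by
    have h := (φ z).le_of_opNorm_le_of_le (hφ.bound z) (hf.bound z)
    have := mul_nonneg hφ.nonneg hf.nonneg
    linarith
  lip z z' := by
    have e : φ z (f z) - φ z' (f z') = (φ z - φ z') (f z) + φ z' (f z - f z') := by simp
    rw [e]
    calc _ ≤ (K * ‖z - z'‖) * L + K * (L * ‖z - z'‖) :=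
          norm_add_le_of_le (ContinuousLinearMap.le_of_opNorm_le_of_le _ (hφ.lip z z') (hf.bound z))
            (ContinuousLinearMap.le_of_opNorm_le_of_le _ (hφ.bound z') (hf.lip z z'))
      _ = _ := by ring

end BddLip

namespace BddLip2

theorem mono {f : V → F} {K L : ℝ} (h : BddLip2 f K) (hKL : K ≤ L) : BddLip2 f L :=
  ⟨h.toBddLip.mono hKL, fun z z' v => (h.lip2 z z' v).trans (by gcongr)⟩

theorem add {f f' : V → F} {K L : ℝ} (h : BddLip2 f K) (h' : BddLip2 f' L) :
    BddLip2 (fun z => f z + f' z) (K + L) where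
  toBddLip := h.toBddLip.add h'.toBddLip
  lip2 z z' v := by
    rw [add_sub_add_comm, add_sub_add_comm, add_sub_add_comm, add_mul, add_mul]
    exact (norm_add_le _ _).trans (add_le_add (h.lip2 z z' v) (h'.lip2 z z' v))

theorem sum {ι : Type*} (s : Finset ι) {f : ι → V → F} {K : ℝ} (h : ∀ i, BddLip2 (f i) K) :
    BddLip2 (fun z => ∑ i ∈ s, f i z) (s.card * K) where
  toBddLip := BddLip.sum s fun i => (h i).toBddLip
  lip2 z z' v := by
    rw [← Finset.sum_sub_distrib, ← Finset.sum_sub_distrib, ← Finset.sum_sub_distrib, mul_assoc,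
      mul_assoc, ← mul_assoc K, ← nsmul_eq_mul]
    exact norm_sum_le_of_le s (fun i _ => (h i).lip2 z z' v) |>.trans (by simp)

/-- The second difference of `f` over a parallelogram-like quadruple of points. -/
theorem lip2' {f : V → F} {K : ℝ} (h : BddLip2 f K) (z z' v v' : V) :
    ‖(f (z + v) - f z) - (f (z' + v') - f z')‖ ≤ K * (‖v‖ * ‖z - z'‖ + ‖v - v'‖) := by
  have e : (f (z + v) - f z) - (f (z' + v') - f z') =
      ((f (z + v) - f z) - (f (z' + v) - f z')) + (f (z' + v) - f (z' + v')) := by abel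
  rw [e]
  calc _ ≤ K * ‖v‖ * ‖z - z'‖ + K * ‖(z' + v) - (z' + v')‖ :=
        norm_add_le_of_le (h.lip2 _ _ _) (h.lip _ _)
    _ = _ := by rw [add_sub_add_left_eq_sub]; ring

/-- The increment of `f` along a displacement field of size `A`. -/
theorem increment {f : V → F} {K A : ℝ} (hf : BddLip2 f K) {v : V → V} (hv : BddLip v A) :
    BddLip (fun z => f (z + v z) - f z) (2 * (K * A)) where
  bound z := by
    have hK := hf.nonneg
    have hA := hv.nonneg
    have h1 := hf.lip (z + v z) z
    rw [add_sub_cancel_left] at h1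
    have h2 : K * ‖v z‖ ≤ K * A := by gcongr; exact hv.bound z
    have h3 : 0 ≤ K * A := by positivity
    linarith
  lip z z' := by
    have hK := hf.nonneg
    calc _ ≤ K * (‖v z‖ * ‖z - z'‖ + ‖v z - v z'‖) := hf.lip2' _ _ _ _
      _ ≤ K * (A * ‖z - z'‖ + A * ‖z - z'‖) := by
          gcongr
          · exact hv.bound z
          · exact hv.lip z z'
      _ = _ := by ring

variable [NormedSpace ℝ F] [NormedSpace ℝ G]

theorem smul {f : V → F} {K : ℝ} (h : BddLip2 f K) {c B : ℝ} (hc : |c| ≤ B) :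
    BddLip2 (fun z => c • f z) (B * K) where
  toBddLip := h.toBddLip.smul hc
  lip2 z z' v := by
    rw [← smul_sub, ← smul_sub, ← smul_sub, norm_smul, mul_assoc, mul_assoc, ← mul_assoc K]
    exact mul_le_mul hc (h.lip2 z z' v) (norm_nonneg _) ((abs_nonneg _).trans hc)

theorem clm_apply {φ : V → F →L[ℝ] G} {f : V → F} {K L : ℝ} (hφ : BddLip2 φ K)
    (hf : BddLip2 f L) : BddLip2 (fun z => φ z (f z)) (4 * (K * L)) where
  toBddLip := (hφ.toBddLip.clm_apply hf.toBddLip).mono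
    (by nlinarith [mul_nonneg hφ.nonneg hf.nonneg])
  lip2 z z' v := by
    have e : (φ (z + v) (f (z + v)) - φ z (f z)) - (φ (z' + v) (f (z' + v)) - φ z' (f z')) =
        (((φ (z + v) - φ z) - (φ (z' + v) - φ z')) (f (z + v)) +
          (φ (z' + v) - φ z') (f (z + v) - f (z' + v))) +
        (φ z ((f (z + v) - f z) - (f (z' + v) - f z')) +
          (φ z - φ z') (f (z' + v) - f z')) := by
      simp only [map_sub, sub_apply]; abel
    rw [e]
    calc _ ≤ ((K * ‖v‖ * ‖z - z'‖) * L + (K * ‖(z' + v) - z'‖) * (L * ‖(z + v) - (z' + v)‖)) +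
          (K * (L * ‖v‖ * ‖z - z'‖) + (K * ‖z - z'‖) * (L * ‖(z' + v) - z'‖)) := by
          refine norm_add_le_of_le (norm_add_le_of_le ?_ ?_) (norm_add_le_of_le ?_ ?_)
          · exact ContinuousLinearMap.le_of_opNorm_le_of_le _ (hφ.lip2 _ _ _) (hf.bound _)
          · exact ContinuousLinearMap.le_of_opNorm_le_of_le _ (hφ.lip _ _) (hf.lip _ _)
          · exact ContinuousLinearMap.le_of_opNorm_le_of_le _ (hφ.bound _) (hf.lip2 _ _ _)
          · exact ContinuousLinearMap.le_of_opNorm_le_of_le _ (hφ.lip _ _) (hf.lip _ _)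
      _ = _ := by rw [add_sub_cancel_left, add_sub_add_right_eq_sub]; ring

/-- A function with two bounded derivatives belongs to the class. -/
theorem of_contDiff [NormedSpace ℝ V] {f : V → F} {K : ℝ} (hf : ContDiff ℝ 2 f)
    (hK : ∀ k ≤ 2, ∀ z, ‖iteratedFDeriv ℝ k f z‖ ≤ K) : BddLip2 f K := by
  have h0 : ∀ z, ‖f z‖ ≤ K := fun z => by simpa using hK 0 (by norm_num) z
  have h1 : ∀ z, ‖fderiv ℝ f z‖ ≤ K := fun z => by
    simpa [norm_iteratedFDeriv_one] using hK 1 (by norm_num) z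
  have h2 : ∀ z, ‖fderiv ℝ (fderiv ℝ f) z‖ ≤ K := fun z => by
    rw [← norm_iteratedFDeriv_one, norm_iteratedFDeriv_fderiv]; exact hK 2 le_rfl z
  have d0 : Differentiable ℝ f := hf.differentiable (by norm_num)
  have d1 : Differentiable ℝ (fderiv ℝ f) :=
    (hf.fderiv_right (m := 1) (by norm_num)).differentiable (by norm_num)
  have l1 : ∀ z z', ‖fderiv ℝ f z - fderiv ℝ f z'‖ ≤ K * ‖z - z'‖ := fun z z' =>
    convex_univ.norm_image_sub_le_of_norm_fderiv_le (fun x _ => d1 x) (fun x _ => h2 x)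
      (mem_univ z') (mem_univ z)
  refine ⟨⟨h0, fun z z' => ?_⟩, fun z z' v => ?_⟩
  · exact convex_univ.norm_image_sub_le_of_norm_fderiv_le (fun x _ => d0 x) (fun x _ => h1 x)
      (mem_univ z') (mem_univ z)
  · refine convex_univ.norm_image_sub_le_of_norm_hasFDerivWithin_le
      (f := fun z => f (z + v) - f z) (f' := fun z => fderiv ℝ f (z + v) - fderiv ℝ f z)
      (fun x _ => ?_) (fun x _ => ?_) (mem_univ z') (mem_univ z)
    · exact (((hasFDerivAt_comp_add_right v).2 (d0 (x + v)).hasFDerivAt).sub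
        (d0 x).hasFDerivAt).hasFDerivWithinAt
    · simpa using l1 (x + v) x

end BddLip2

/-! ### First order Taylor remainders -/

variable [NormedSpace ℝ V] [NormedSpace ℝ F]

/-- The first order Taylor remainder of `f` at `z`. -/
noncomputable def taylorRem (f : V → F) (z v : V) : F := f (z + v) - f z - fderiv ℝ f z v

theorem hasFDerivAt_taylorRem {f : V → F} (hf : Differentiable ℝ f) (z v : V) :
    HasFDerivAt (taylorRem f z) (fderiv ℝ f (z + v) - fderiv ℝ f z) v := by
  have h := (((hasFDerivAt_comp_add_left z).2 (hf (z + v)).hasFDerivAt).sub_const (f z)).sub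
    (fderiv ℝ f z).hasFDerivAt
  exact h

theorem norm_taylorRem_sub_right_le {f : V → F} {K : ℝ} (hf : Differentiable ℝ f)
    (hK : BddLip (fderiv ℝ f) K) (z : V) {v v' : V} {ρ : ℝ} (hv : ‖v‖ ≤ ρ) (hv' : ‖v'‖ ≤ ρ) :
    ‖taylorRem f z v - taylorRem f z v'‖ ≤ K * ρ * ‖v - v'‖ := by
  refine (convex_closedBall (0 : V) ρ).norm_image_sub_le_of_norm_hasFDerivWithin_le
    (fun w _ => (hasFDerivAt_taylorRem hf z w).hasFDerivWithinAt) (fun w hw => ?_)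
    (by simpa using hv') (by simpa using hv)
  have h := hK.lip (z + w) z
  rw [add_sub_cancel_left] at h
  exact h.trans (mul_le_mul_of_nonneg_left (by simpa using hw) hK.nonneg)

theorem norm_taylorRem_le {f : V → F} {K : ℝ} (hf : Differentiable ℝ f)
    (hK : BddLip (fderiv ℝ f) K) (z v : V) : ‖taylorRem f z v‖ ≤ K * ‖v‖ ^ 2 := by
  have h := norm_taylorRem_sub_right_le hf hK z (le_refl ‖v‖) (v' := 0) (by simp)
  simpa [taylorRem, pow_two, mul_assoc] using h

theorem norm_taylorRem_sub_left_le {f : V → F} {K : ℝ} (hf : Differentiable ℝ f)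
    (hK : BddLip2 (fderiv ℝ f) K) (z z' v : V) :
    ‖taylorRem f z v - taylorRem f z' v‖ ≤ K * ‖v‖ ^ 2 * ‖z - z'‖ := by
  have h := (convex_closedBall (0 : V) ‖v‖).norm_image_sub_le_of_norm_hasFDerivWithin_le
    (f := fun w => taylorRem f z w - taylorRem f z' w) (C := K * ‖v‖ * ‖z - z'‖)
    (fun w _ => ((hasFDerivAt_taylorRem hf z w).sub
      (hasFDerivAt_taylorRem hf z' w)).hasFDerivWithinAt) (fun w hw => ?_)
    (x := 0) (y := v) (by simp) (by simp)
  · simpa [taylorRem, pow_two, mul_assoc, mul_comm, mul_left_comm] using h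
  · have hw' : ‖w‖ ≤ ‖v‖ := by simpa using hw
    refine (hK.lip2 z z' w).trans ?_
    have := hK.nonneg
    gcongr

/-- The Taylor remainder along a displacement field `v` of size `ρ` is of size `ρ²`, together with
its Lipschitz constant. -/
theorem BddLip.taylorRem {f : V → F} {K A : ℝ} (hf : Differentiable ℝ f)
    (hK : BddLip2 (fderiv ℝ f) K) {v : V → V} (hv : BddLip v A) :
    BddLip (fun z => taylorRem f z (v z)) (2 * (K * A ^ 2)) where
  bound z := by
    have := hK.nonneg
    have hA := hv.nonneg
    have h1 : K * ‖v z‖ ^ 2 ≤ K * A ^ 2 := by gcongr; exact hv.bound z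
    have h2 : 0 ≤ K * A ^ 2 := by positivity
    linarith [norm_taylorRem_le hf hK.toBddLip z (v z)]
  lip z z' := by
    have := hK.nonneg
    have hA := hv.nonneg
    rw [← sub_add_sub_cancel _ (TaylorODE.taylorRem f z' (v z))]
    calc _ ≤ K * ‖v z‖ ^ 2 * ‖z - z'‖ + K * A * ‖v z - v z'‖ :=
          norm_add_le_of_le (norm_taylorRem_sub_left_le hf hK _ _ _)
            (norm_taylorRem_sub_right_le hf hK.toBddLip _ (hv.bound _) (hv.bound _))
      _ ≤ K * A ^ 2 * ‖z - z'‖ + K * A * (A * ‖z - z'‖) := by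
          gcongr
          · exact hv.bound z
          · exact hv.lip z z'
      _ = _ := by ring

end FunctionClasses

variable {d l : ℕ}

/-! ### The increment of one Taylor step -/

/-- The bounds on the vector fields `g` and on their products `𝒟^{(i)} g^{(j)}` that hold for
`g ∈ C³_b`. -/
structure FieldBounds (g : Fin l → E d → E d) (K : ℝ) : Prop where
  differentiable : ∀ i, Differentiable ℝ (g i)
  field : ∀ i, BddLip2 (g i) K
  fderiv : ∀ i, BddLip2 (fderiv ℝ (g i)) K
  dirDeriv : ∀ i j, BddLip2 (dirDeriv g i j) K

theorem exists_fieldBounds {g : Fin l → E d → E d} (hg : ∀ i, IsC3b (g i)) :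
    ∃ K, 1 ≤ K ∧ FieldBounds g K := by
  have h : ∀ i, ∃ K : ℝ, 0 ≤ K ∧ ∀ k ≤ 3, ∀ z, ‖iteratedFDeriv ℝ k (g i) z‖ ≤ K := by
    intro i
    choose K hK using (hg i).2
    refine ⟨∑ k : Fin 4, |K k (by omega)|, by positivity, fun k hk z => (hK k hk z).trans ?_⟩
    exact (le_abs_self _).trans (Finset.single_le_sum (f := fun k : Fin 4 => |K k (by omega)|)
      (fun _ _ => abs_nonneg _) (Finset.mem_univ ⟨k, by omega⟩))
  choose K0 hK0 hK using h
  set K := ∑ i, K0 i with hKdef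
  have hKK : ∀ i, K0 i ≤ K := fun i =>
    Finset.single_le_sum (f := K0) (fun i _ => hK0 i) (Finset.mem_univ i)
  have hK' : ∀ i, ∀ k ≤ 3, ∀ z, ‖iteratedFDeriv ℝ k (g i) z‖ ≤ K := fun i k hk z =>
    (hK i k hk z).trans (hKK i)
  have f0 : ∀ i, BddLip2 (g i) K := fun i =>
    BddLip2.of_contDiff ((hg i).1.of_le (by norm_num)) fun k hk z => hK' i k (by omega) z
  have f1 : ∀ i, BddLip2 (fderiv ℝ (g i)) K := fun i =>
    BddLip2.of_contDiff ((hg i).1.fderiv_right (by norm_num)) fun k hk z => by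
      rw [norm_iteratedFDeriv_fderiv]; exact hK' i (k + 1) (by omega) z
  have hK0 : 0 ≤ K := Finset.sum_nonneg fun i _ => hK0 i
  refine ⟨1 + K + 4 * (K * K), by nlinarith, fun i => (hg i).1.differentiable (by norm_num),
    fun i => (f0 i).mono (by nlinarith), fun i => (f1 i).mono (by nlinarith),
    fun i j => ((f1 j).clm_apply (f0 i)).mono (by nlinarith)⟩

/-- The increment `Ψ(z) - z` of a Taylor step driven by the first and second order increments
`X` and `XX`. -/
noncomputable def stepIncr (g : Fin l → E d → E d) (X : Fin l → ℝ) (XX : Fin l → Fin l → ℝ)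
    (z : E d) : E d :=
  ∑ i, X i • g i z + ∑ i, ∑ j, XX i j • dirDeriv g i j z

theorem bddLip2_sum_dirDeriv {g : Fin l → E d → E d} {K N : ℝ} (hg : FieldBounds g K)
    {XX : Fin l → Fin l → ℝ} (hXX : ∀ i j, |XX i j| ≤ N) :
    BddLip2 (fun z => ∑ i, ∑ j, XX i j • dirDeriv g i j z) (l * (l * (N * K))) := by
  have h := BddLip2.sum Finset.univ fun i => BddLip2.sum Finset.univ fun j =>
    (hg.dirDeriv i j).smul (hXX i j)
  simpa using h

theorem bddLip2_stepIncr {g : Fin l → E d → E d} {K N : ℝ} (hg : FieldBounds g K)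
    {X : Fin l → ℝ} {XX : Fin l → Fin l → ℝ} (hX : ∀ i, |X i| ≤ N) (hXX : ∀ i j, |XX i j| ≤ N) :
    BddLip2 (stepIncr g X XX) ((l + l * l) * (N * K)) := by
  have h := (BddLip2.sum Finset.univ fun i => (hg.field i).smul (hX i)).add
    (bddLip2_sum_dirDeriv hg hXX)
  refine BddLip2.mono h (le_of_eq ?_)
  simp; ring

/-- The defect `Ψ_{ut} ∘ Ψ_{su} - Ψ_{st}` of the flow property, when the increments satisfy Chen's
relation. -/
theorem stepIncr_defect_eq (g : Fin l → E d → E d)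
    (X Y Z : Fin l → ℝ) (XX YY ZZ : Fin l → Fin l → ℝ) (hZ : ∀ i, Z i = X i + Y i)
    (hZZ : ∀ i j, ZZ i j = XX i j + YY i j + X i * Y j) (z : E d) :
    stepIncr g X XX z + stepIncr g Y YY (z + stepIncr g X XX z) - stepIncr g Z ZZ z =
      ∑ j, Y j • (taylorRem (g j) z (stepIncr g X XX z) +
        fderiv ℝ (g j) z (∑ i, ∑ k, XX i k • dirDeriv g i k z)) +
      ∑ i, ∑ j, YY i j • (dirDeriv g i j (z + stepIncr g X XX z) - dirDeriv g i j z) := by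
  set v := stepIncr g X XX z with hv
  set p := ∑ i, ∑ k, XX i k • dirDeriv g i k z with hp
  have hvp : v = ∑ i, X i • g i z + p := rfl
  have e1 : ∀ j, taylorRem (g j) z v + fderiv ℝ (g j) z p =
      g j (z + v) - g j z - ∑ i, X i • dirDeriv g i j z := by
    intro j
    rw [taylorRem, hvp, map_add, map_sum]
    simp only [map_smul, dirDeriv]
    abel
  simp only [e1, smul_sub, Finset.sum_sub_distrib]
  have e2 : ∑ i, ∑ j, (X i * Y j) • dirDeriv g i j z =
      ∑ j, Y j • ∑ i, X i • dirDeriv g i j z := by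
    rw [Finset.sum_comm]
    refine Finset.sum_congr rfl fun j _ => ?_
    rw [Finset.smul_sum]
    exact Finset.sum_congr rfl fun i _ => by rw [smul_smul, mul_comm]
  have e3 : stepIncr g Z ZZ z = ∑ i, X i • g i z + ∑ i, Y i • g i z + (p +
      ∑ i, ∑ j, YY i j • dirDeriv g i j z + ∑ j, Y j • ∑ i, X i • dirDeriv g i j z) := by
    rw [← e2]
    simp only [stepIncr, hZ, hZZ, add_smul, Finset.sum_add_distrib, hp]
  rw [e3, stepIncr, hvp]
  abel

/-- With increments of sizes `ρ` and `ρ²`, the defect of the flow property of the Taylor step is of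
size `ρ³`, as a bounded Lipschitz function of the starting point. -/
theorem exists_bddLip_stepIncr_defect {g : Fin l → E d → E d} {K : ℝ} (hg : FieldBounds g K)
    {N : ℝ} (hN : 0 ≤ N) : ∃ C, 0 ≤ C ∧
      ∀ (ρ : ℝ) (X Y Z : Fin l → ℝ) (XX YY ZZ : Fin l → Fin l → ℝ),
      0 ≤ ρ → ρ ≤ 1 → (∀ i, |X i| ≤ N * ρ) → (∀ i, |Y i| ≤ N * ρ) →
      (∀ i j, |XX i j| ≤ N * ρ ^ 2) → (∀ i j, |YY i j| ≤ N * ρ ^ 2) →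
      (∀ i, Z i = X i + Y i) → (∀ i j, ZZ i j = XX i j + YY i j + X i * Y j) →
      BddLip (fun z => stepIncr g X XX z + stepIncr g Y YY (z + stepIncr g X XX z) -
        stepIncr g Z ZZ z) (C * ρ ^ 3) := by
  rcases Nat.eq_zero_or_pos l with rfl | hl
  · refine ⟨0, le_rfl, fun ρ X Y Z XX YY ZZ _ _ _ _ _ _ _ _ => ⟨?_, ?_⟩⟩ <;> simp [stepIncr]
  have hK : 0 ≤ K := (hg.field ⟨0, hl⟩).nonneg
  set A := ((l : ℝ) + l * l) * (N * K) with hA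
  have hA0 : 0 ≤ A := by positivity
  refine ⟨l * (N * (2 * (K * A ^ 2) + 2 * (K * A))) + l * (l * (N * (2 * (K * A)))),
    by positivity, fun ρ X Y Z XX YY ZZ hρ hρ1 hX hY hXX hYY hZ hZZ => ?_⟩
  have hρ2 : ρ ^ 2 ≤ ρ := by nlinarith
  have hv : BddLip (stepIncr g X XX) (A * ρ) :=
    (bddLip2_stepIncr hg hX fun i j => (hXX i j).trans
      (mul_le_mul_of_nonneg_left hρ2 hN)).toBddLip.mono (by rw [hA]; apply le_of_eq; ring)
  have hp : BddLip (fun z => ∑ i, ∑ j, XX i j • dirDeriv g i j z) (A * ρ ^ 2) :=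
    (bddLip2_sum_dirDeriv hg hXX).toBddLip.mono (by
      have : (0 : ℝ) ≤ l * (N * K) * ρ ^ 2 := by positivity
      rw [hA]; linarith)
  have h1 := fun j => ((BddLip.taylorRem (hg.differentiable j) (hg.fderiv j) hv).add
    ((hg.fderiv j).toBddLip.clm_apply hp)).smul (hY j)
  have h2 := fun i j => ((hg.dirDeriv i j).increment hv).smul (hYY i j)
  have h3 := (BddLip.sum Finset.univ h1).add
    (BddLip.sum Finset.univ fun i => BddLip.sum Finset.univ (h2 i))
  have h4 : (fun z => stepIncr g X XX z + stepIncr g Y YY (z + stepIncr g X XX z) -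
      stepIncr g Z ZZ z) = _ :=
    funext fun z => stepIncr_defect_eq g X Y Z XX YY ZZ hZ hZZ z
  rw [h4]
  refine BddLip.mono h3 (le_of_eq ?_)
  simp only [Finset.card_univ, Fintype.card_fin]
  ring

/-! ### A sewing estimate along dyadic subdivisions -/

theorem exists_pos_mul_rpow_le (C : ℝ) {γ δ : ℝ} (hγ : 0 < γ) (hδ : 0 < δ) :
    ∃ h, 0 < h ∧ h ≤ 1 ∧ ∀ r, 0 ≤ r → r ≤ h → C * r ^ γ ≤ δ := by
  have hc : Filter.Tendsto (fun r : ℝ => |C| * r ^ γ) (nhds 0) (nhds 0) := by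
    have h : ContinuousAt (fun r : ℝ => |C| * r ^ γ) 0 :=
      (Real.continuousAt_rpow_const 0 γ (Or.inr hγ.le)).const_mul _
    simpa [ContinuousAt, Real.zero_rpow hγ.ne'] using h
  obtain ⟨h, h0, hh⟩ := Metric.eventually_nhds_iff.1 (hc.eventually (gt_mem_nhds hδ))
  refine ⟨min 1 (h / 2), by positivity, min_le_left _ _, fun r hr hrh => ?_⟩
  have hr' : dist r 0 < h := by
    rw [Real.dist_eq, sub_zero, abs_of_nonneg hr]
    linarith [min_le_right 1 (h / 2)]
  exact (mul_le_mul_of_nonneg_right (le_abs_self C) (Real.rpow_nonneg hr γ)).trans (hh hr').le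

/-- A sewing estimate: `J` is almost subadditive along midpoint subdivisions up to an error of order
`θ > 1`, and on small intervals it is negligible against the increments of some monotone `ω`. Then
`J` is of order `θ`, with a constant that does not depend on `ω`.

The proof is by induction on the length of the interval, measured in powers of two: the bound
`J s t ≤ A D (t - s) ^ θ + ε (1 + κ (t - s) ^ γ) (ω t - ω s)` is stable under doubling, where the
weight `1 + κ (t - s) ^ γ` absorbs the factors `1 + c (t - s) ^ γ`. -/
theorem exists_sewing_bound {c γ θ : ℝ} (hc : 0 ≤ c) (hγ : 0 < γ) (hθ : 1 < θ) :
    ∃ h A, 0 < h ∧ h ≤ 1 ∧ 0 < A ∧ ∀ (J : ℝ → ℝ → ℝ) (ω : ℝ → ℝ) (a b D : ℝ), 0 ≤ D →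
      MonotoneOn ω (Icc a b) →
      (∀ s t, a ≤ s → s ≤ t → t ≤ b → t - s ≤ h →
        J s t ≤ (1 + c * (t - s) ^ γ) * (J s ((s + t) / 2) + J ((s + t) / 2) t) +
          D * (t - s) ^ θ) →
      (∀ ε > 0, ∃ η > 0, ∀ s t, a ≤ s → s ≤ t → t ≤ b → t - s ≤ η → J s t ≤ ε * (ω t - ω s)) →
      ∀ s t, a ≤ s → s ≤ t → t ≤ b → t - s ≤ h → J s t ≤ A * D * (t - s) ^ θ := by
  set q : ℝ := (1 / 2) ^ γ with hq
  set P : ℝ := (1 / 2) ^ θ with hP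
  have hq0 : 0 < q := by positivity
  have hP0 : 0 < P := by positivity
  have hq1 : q < 1 := Real.rpow_lt_one (by norm_num) (by norm_num) hγ
  have hP1 : 2 * P < 1 := by
    have : P < (1 / 2 : ℝ) ^ (1 : ℝ) :=
      Real.rpow_lt_rpow_of_exponent_gt (by norm_num) (by norm_num) hθ
    rw [Real.rpow_one] at this
    linarith
  obtain ⟨h, h0, h1, hh⟩ := exists_pos_mul_rpow_le c hγ
    (δ := min ((1 - 2 * P) / 2) ((1 - q) / 2)) (lt_min (by linarith) (by linarith))
  -- `h`, `κ` and `A` make the induction step work: `(1 + c r ^ γ) 2 P A + 1 ≤ A` and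
  -- `(1 + c r ^ γ) (1 + κ q r ^ γ) ≤ 1 + κ r ^ γ` for `r ≤ h`
  set κ : ℝ := 2 * c / (1 - q) with hκ
  have hκ0 : 0 ≤ κ := div_nonneg (by linarith) (by linarith)
  have hκ1 : κ * (1 - q) = 2 * c := by rw [hκ]; field_simp [(by linarith : (1 - q) ≠ 0)]
  set A : ℝ := 2 / (1 - 2 * P) with hA
  have hA0 : 0 < A := div_pos (by norm_num) (by linarith)
  have hA1 : A * (1 - 2 * P) = 2 := by rw [hA]; field_simp [(by linarith : (1 - 2 * P) ≠ 0)]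
  refine ⟨h, A, h0, h1, hA0, fun J ω a b D hD hω hJ hsmall s t has hst htb hsth => ?_⟩
  -- `n` counts the doublings of the scale `η` on which `J` is negligible; it does not enter the bound
  have key : ∀ ε > 0, ∃ η > 0, ∀ n : ℕ, ∀ s t, a ≤ s → s ≤ t → t ≤ b → t - s ≤ h →
      t - s ≤ η * 2 ^ n →
      J s t ≤ A * D * (t - s) ^ θ + ε * (1 + κ * (t - s) ^ γ) * (ω t - ω s) := by
    intro ε hε
    obtain ⟨η, hη, H⟩ := hsmall ε hε
    refine ⟨η, hη, fun n => ?_⟩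
    induction n with
    | zero =>
      intro s t has hst htb _ hr
      have h1 := H s t has hst htb (by simpa using hr)
      have h2 : 0 ≤ t - s := by linarith
      have h3 : 0 ≤ ω t - ω s :=
        sub_nonneg.2 (hω ⟨has, hst.trans htb⟩ ⟨has.trans hst, htb⟩ hst)
      have h4 : 0 ≤ A * D * (t - s) ^ θ := by positivity
      have h5 : 0 ≤ ε * (κ * (t - s) ^ γ) * (ω t - ω s) := by positivity
      linarith
    | succ n ih =>
      intro s t has hst htb hrh hr
      set r := t - s with hrdef
      have hr0 : 0 ≤ r := by linarith
      set u := (s + t) / 2 with hu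
      have e1 : u - s = r * (1 / 2) := by rw [hu, hrdef]; ring
      have e2 : t - u = r * (1 / 2) := by rw [hu, hrdef]; ring
      have hr' : r * (1 / 2) ≤ η * 2 ^ n := by rw [pow_succ] at hr; linarith
      have i1 := ih s u has (by linarith) (by linarith) (by linarith) (by linarith)
      have i2 := ih u t (by linarith) (by linarith) htb (by linarith) (by linarith)
      have hJ' := hJ s t has hst htb hrh
      rw [e1, Real.mul_rpow hr0 (by norm_num), Real.mul_rpow hr0 (by norm_num), ← hq, ← hP] at i1
      rw [e2, Real.mul_rpow hr0 (by norm_num), Real.mul_rpow hr0 (by norm_num), ← hq, ← hP] at i2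
      rw [← hrdef] at hJ'
      have hX := hh r hr0 hrh
      have hX1 := hX.trans (min_le_left _ _)
      have hX2 := hX.trans (min_le_right _ _)
      have hX0 : 0 ≤ r ^ γ := Real.rpow_nonneg hr0 γ
      have hR0 : 0 ≤ r ^ θ := Real.rpow_nonneg hr0 θ
      generalize r ^ γ = X at *
      generalize r ^ θ = R at *
      have hW : 0 ≤ ω t - ω s :=
        sub_nonneg.2 (hω ⟨has, hst.trans htb⟩ ⟨has.trans hst, htb⟩ hst)
      have hcX : 0 ≤ c * X := by positivity
      have hsum : J s u + J u t ≤ A * D * R * (2 * P) + ε * (1 + κ * q * X) * (ω t - ω s) := by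
        linarith
      have b1 : (1 + c * X) * (2 * P) * A + 1 ≤ A := by
        have : (1 + c * X) * (2 * P) ≤ 2 * P + (1 - 2 * P) / 2 := by
          have := mul_le_mul hX1 hP1.le (by positivity) (by linarith)
          linarith
        have := mul_le_mul_of_nonneg_right this hA0.le
        linarith
      have b2 : (1 + c * X) * (1 + κ * q * X) ≤ 1 + κ * X := by
        have h1 : q * (1 + c * X) ≤ q + (1 - q) / 2 := by
          have := mul_le_mul hq1.le hX2 hcX (by norm_num)
          linarith
        have h2 := mul_le_mul_of_nonneg_left h1 (mul_nonneg hκ0 hX0)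
        have h3 : c * X = κ * (1 - q) * X / 2 := by rw [hκ1]; ring
        linarith
      calc J s t ≤ (1 + c * X) * (J s u + J u t) + D * R := hJ'
        _ ≤ (1 + c * X) * (A * D * R * (2 * P) + ε * (1 + κ * q * X) * (ω t - ω s)) + D * R := by
            gcongr
        _ = ((1 + c * X) * (2 * P) * A + 1) * (D * R) +
            ((1 + c * X) * (1 + κ * q * X)) * (ε * (ω t - ω s)) := by ring
        _ ≤ A * (D * R) + (1 + κ * X) * (ε * (ω t - ω s)) := by gcongr
        _ = _ := by ring
  have hW : 0 ≤ ω t - ω s := sub_nonneg.2 (hω ⟨has, hst.trans htb⟩ ⟨has.trans hst, htb⟩ hst)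
  have hr0 : 0 ≤ t - s := by linarith
  have hB : 0 ≤ (1 + κ * (t - s) ^ γ) * (ω t - ω s) := by positivity
  refine le_of_forall_pos_le_add fun δ hδ => ?_
  obtain ⟨η, hη, H⟩ := key (δ / ((1 + κ * (t - s) ^ γ) * (ω t - ω s) + 1)) (by positivity)
  obtain ⟨n, hn⟩ := pow_unbounded_of_one_lt ((t - s) / η) (one_lt_two)
  refine (H n s t has hst htb hsth ?_).trans ?_
  · rw [div_lt_iff₀ hη] at hn; linarith
  · rw [mul_assoc (δ / _)]
    generalize (1 + κ * (t - s) ^ γ) * (ω t - ω s) = B at *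
    have : δ / (B + 1) * B ≤ δ := by
      rw [div_mul_eq_mul_div, div_le_iff₀ (by linarith)]
      nlinarith
    linarith

/-! ### From local to global Hölder bounds -/

/-- If the increments of `f` over short intervals are bounded by the size of `f` at the left end,
then so are those over `[a, T]`. -/
theorem exists_norm_sub_le_of_local {γ B h T : ℝ} (hγ : 0 < γ) (hB : 0 ≤ B)
    (hh : 0 < h) (hh1 : h ≤ 1) : ∃ C, 0 ≤ C ∧
      ∀ {V : Type} [NormedAddCommGroup V] (f : ℝ → V) (a : ℝ),
      0 ≤ a →
      (∀ s t, a ≤ s → s ≤ t → t ≤ T → t - s ≤ h → ‖f t - f s‖ ≤ B * (t - s) ^ γ * ‖f s‖) →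
      ∀ t, a ≤ t → t ≤ T → ‖f t - f a‖ ≤ C * (t - a) ^ γ * ‖f a‖ := by
  obtain ⟨n, hn⟩ := exists_nat_ge (T / h)
  rw [div_le_iff₀ hh] at hn
  set L : ℝ := (1 + B) ^ n with hL
  have hL0 : 0 ≤ L := by positivity
  refine ⟨B + (L + 1) / h ^ γ, by positivity, fun {V} _ f a ha0 hf t hat htT => ?_⟩
  have grow : ∀ m : ℕ, ∀ t, a ≤ t → t ≤ T → t - a ≤ m * h → ‖f t‖ ≤ (1 + B) ^ m * ‖f a‖ := by
    intro m
    induction m with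
    | zero =>
      intro t hat _ hm
      have : t = a := by simp at hm; linarith
      simp [this]
    | succ m ih =>
      intro t hat htT hm
      push_cast at hm
      -- one step of length at most `h` from `u`
      set u := max a (t - h) with hu
      have h1 : t - u ≤ h := by linarith [le_max_right a (t - h)]
      have h2 : u ≤ t := max_le hat (by linarith)
      have h3 : a ≤ u := le_max_left _ _
      have h4 : u - a ≤ m * h := by
        rw [sub_le_iff_le_add]
        exact max_le (by have : 0 ≤ m * h := by positivity
                         linarith) (by linarith)
      have i1 := ih u h3 (by linarith) h4
      have i2 := hf u t h3 h2 htT h1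
      have h5 : (t - u) ^ γ ≤ 1 := Real.rpow_le_one (by linarith) (by linarith) hγ.le
      have h6 : B * (t - u) ^ γ * ‖f u‖ ≤ B * 1 * ‖f u‖ := by gcongr
      have h7 : ‖f t‖ ≤ ‖f t - f u‖ + ‖f u‖ := by simpa using norm_add_le (f t - f u) (f u)
      calc ‖f t‖ ≤ (1 + B) * ‖f u‖ := by linarith
        _ ≤ (1 + B) * ((1 + B) ^ m * ‖f a‖) := by gcongr
        _ = _ := by ring
  have hta : 0 ≤ t - a := by linarith
  by_cases hth : t - a ≤ h
  · refine (hf a t le_rfl hat htT hth).trans ?_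
    gcongr
    have : 0 ≤ (L + 1) / h ^ γ := by positivity
    linarith
  · have h1 := grow n t hat htT (by linarith)
    have h2 : ‖f t - f a‖ ≤ (L + 1) * ‖f a‖ := by
      have := norm_sub_le (f t) (f a)
      linarith
    have h3 : h ^ γ ≤ (t - a) ^ γ := Real.rpow_le_rpow hh.le (by linarith) hγ.le
    have h4 : (0 : ℝ) < h ^ γ := by positivity
    have h5 : L + 1 ≤ (L + 1) / h ^ γ * (t - a) ^ γ := by
      rw [div_mul_eq_mul_div, le_div_iff₀ h4]
      gcongr
    have h6 : 0 ≤ B * (t - a) ^ γ := by positivity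
    calc ‖f t - f a‖ ≤ (L + 1) * ‖f a‖ := h2
      _ ≤ ((B + (L + 1) / h ^ γ) * (t - a) ^ γ) * ‖f a‖ := by
          gcongr
          linarith

/-! ### Increments of the driving path -/

/-- The length `∫_0^t |ẋ_u| du` of the path up to time `t`. -/
noncomputable def arcLength (x : ℝ → E l) (t : ℝ) : ℝ := ∫ u in (0 : ℝ)..t, ‖deriv x u‖

namespace IsPiecewiseDifferentiable

variable {T : ℝ} {x : ℝ → E l}

theorem intervalIntegrable_deriv (hx : IsPiecewiseDifferentiable T x) {s t : ℝ} (hs : 0 ≤ s)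
    (hst : s ≤ t) (ht : t ≤ T) : IntervalIntegrable (deriv x) volume s t :=
  hx.integrable_deriv.mono_set (by
    rw [uIcc_of_le hst, uIcc_of_le (hs.trans (hst.trans ht))]; exact Icc_subset_Icc hs ht)

theorem intervalIntegrable_deriv_apply (hx : IsPiecewiseDifferentiable T x) (i : Fin l) {s t : ℝ}
    (hs : 0 ≤ s) (hst : s ≤ t) (ht : t ≤ T) :
    IntervalIntegrable (fun u => deriv x u i) volume s t := by
  have h := hx.intervalIntegrable_deriv hs hst ht
  exact ⟨(EuclideanSpace.proj (𝕜 := ℝ) i).integrable_comp h.1,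
    (EuclideanSpace.proj (𝕜 := ℝ) i).integrable_comp h.2⟩

theorem integral_deriv_apply (hx : IsPiecewiseDifferentiable T x) (i : Fin l) {s t : ℝ}
    (hs : 0 ≤ s) (hst : s ≤ t) (ht : t ≤ T) : ∫ u in s..t, deriv x u i = x t i - x s i := by
  obtain ⟨F, hF⟩ := hx.differentiableAt
  refine integral_eq_of_hasDerivAt_off_countable_of_le (fun u => x u i) (fun u => deriv x u i) hst
    F.countable_toSet ?_ (fun u hu => ?_) (hx.intervalIntegrable_deriv_apply i hs hst ht)
  · exact (EuclideanSpace.proj (𝕜 := ℝ) i).continuous.comp_continuousOn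
      (hx.continuousOn.mono (Icc_subset_Icc hs ht))
  · have h := (hF u ⟨hs.trans_lt hu.1.1, hu.1.2.trans_le ht⟩ (by simpa using hu.2)).hasDerivAt
    exact (EuclideanSpace.proj (𝕜 := ℝ) i).hasFDerivAt.comp_hasDerivAt u h

theorem arcLength_sub (hx : IsPiecewiseDifferentiable T x) {s t : ℝ} (hs : 0 ≤ s)
    (hst : s ≤ t) (ht : t ≤ T) : arcLength x t - arcLength x s = ∫ u in s..t, ‖deriv x u‖ :=
  intervalIntegral.integral_interval_sub_left
    (hx.intervalIntegrable_deriv le_rfl (hs.trans hst) ht).norm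
    (hx.intervalIntegrable_deriv le_rfl hs (hst.trans ht)).norm

theorem arcLength_mono (hx : IsPiecewiseDifferentiable T x) {s t : ℝ} (hs : 0 ≤ s)
    (hst : s ≤ t) (ht : t ≤ T) : arcLength x s ≤ arcLength x t := by
  rw [← sub_nonneg, hx.arcLength_sub hs hst ht]
  exact intervalIntegral.integral_nonneg hst fun _ _ => norm_nonneg _

theorem continuousOn_arcLength (hx : IsPiecewiseDifferentiable T x) (hT : 0 ≤ T) :
    ContinuousOn (arcLength x) (Icc 0 T) := by
  have h := intervalIntegral.continuousOn_primitive_interval' hx.integrable_deriv.norm left_mem_uIcc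
  rwa [uIcc_of_le hT] at h

theorem M_eq (hx : IsPiecewiseDifferentiable T x) {s t : ℝ} (hs : 0 ≤ s)
    (hst : s ≤ t) (ht : t ≤ T) : M x s t = (arcLength x t - arcLength x s) ^ 3 := by
  rw [M, ← hx.arcLength_sub hs hst ht,
    abs_of_nonneg (sub_nonneg.2 (hx.arcLength_mono hs hst ht))]

theorem intervalIntegrable_smul (hx : IsPiecewiseDifferentiable T x) (i : Fin l) {V : Type*}
    [NormedAddCommGroup V] [NormedSpace ℝ V] {s t : ℝ} (hs : 0 ≤ s) (hst : s ≤ t) (ht : t ≤ T)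
    {φ : ℝ → V} (hφ : ContinuousOn φ (Icc s t)) :
    IntervalIntegrable (fun u => deriv x u i • φ u) volume s t :=
  (hx.intervalIntegrable_deriv_apply i hs hst ht).smul_continuousOn (by rwa [uIcc_of_le hst])

theorem norm_integral_smul_le (hx : IsPiecewiseDifferentiable T x) (i : Fin l) {V : Type*}
    [NormedAddCommGroup V] [NormedSpace ℝ V] {s t : ℝ} (hs : 0 ≤ s) (hst : s ≤ t) (ht : t ≤ T)
    {φ : ℝ → V} {B : ℝ} (hφ : ∀ u ∈ Icc s t, ‖φ u‖ ≤ B) :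
    ‖∫ u in s..t, deriv x u i • φ u‖ ≤ B * (arcLength x t - arcLength x s) := by
  rw [hx.arcLength_sub hs hst ht, ← intervalIntegral.integral_const_mul]
  refine intervalIntegral.norm_integral_le_of_norm_le hst (ae_of_all _ fun u hu => ?_)
    ((hx.intervalIntegrable_deriv hs hst ht).norm.const_mul B)
  rw [norm_smul, mul_comm B]
  exact mul_le_mul (PiLp.norm_apply_le (deriv x u) i) (hφ u (Ioc_subset_Icc_self hu))
    (norm_nonneg _) (norm_nonneg _)

/-- Chen's relation for the iterated integrals. -/
theorem iteratedIntegral_chen (hx : IsPiecewiseDifferentiable T x) (i j : Fin l) {s u t : ℝ}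
    (hs : 0 ≤ s) (hsu : s ≤ u) (hut : u ≤ t) (ht : t ≤ T) :
    iteratedIntegral x i j s t = iteratedIntegral x i j s u + iteratedIntegral x i j u t +
      (x u i - x s i) * (x t j - x u j) := by
  have hint : ∀ c a b : ℝ, 0 ≤ a → a ≤ b → b ≤ T →
      IntervalIntegrable (fun r => (x r i - c) * deriv x r j) volume a b := by
    intro c a b ha hab hb
    have h := hx.intervalIntegrable_smul j ha hab hb (φ := fun r => x r i - c)
      (((EuclideanSpace.proj (𝕜 := ℝ) i).continuous.comp_continuousOn
        (hx.continuousOn.mono (Icc_subset_Icc ha hb))).sub continuousOn_const)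
    simpa only [smul_eq_mul, mul_comm] using h
  have e : ∀ r, (x r i - x s i) * deriv x r j =
      (x r i - x u i) * deriv x r j + (x u i - x s i) * deriv x r j := fun r => by ring
  have hu0 := hs.trans hsu
  rw [iteratedIntegral, ← intervalIntegral.integral_add_adjacent_intervals
    (hint _ s u hs hsu (hut.trans ht)) (hint _ u t hu0 hut ht), iteratedIntegral, iteratedIntegral,
    add_assoc, ← hx.integral_deriv_apply j hu0 hut ht, ← intervalIntegral.integral_const_mul,
    ← intervalIntegral.integral_add (hint _ u t hu0 hut ht)
      ((hx.intervalIntegrable_deriv_apply j hu0 hut ht).const_mul _)]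
  simp only [e]

/-- The derivative of `exp (λ ω)` with `ω` the arc length is `λ |ẋ| exp (λ ω)` almost everywhere;
as `exp (λ ω)` is monotone, its increments dominate the integral of this derivative. -/
theorem integral_norm_deriv_mul_exp_le (hx : IsPiecewiseDifferentiable T x) {c : ℝ} (hc : 0 ≤ c)
    {s t : ℝ} (hs : 0 ≤ s) (hst : s ≤ t) (ht : t ≤ T) :
    ∫ u in s..t, c * (‖deriv x u‖ * Real.exp (c * arcLength x u)) ≤
      Real.exp (c * arcLength x t) := by
  have hT : 0 ≤ T := hs.trans (hst.trans ht)
  have hmono : MonotoneOn (fun u => Real.exp (c * arcLength x u)) (uIcc s t) := by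
    rw [uIcc_of_le hst]
    intro a ha b hb hab
    have := hx.arcLength_mono (hs.trans ha.1) hab (hb.2.trans ht)
    simp only
    gcongr
  have h1 := hmono.intervalIntegral_deriv_mem_uIcc
  have h2 : ∫ u in s..t, deriv (fun u => Real.exp (c * arcLength x u)) u =
      ∫ u in s..t, c * (‖deriv x u‖ * Real.exp (c * arcLength x u)) := by
    refine intervalIntegral.integral_congr_ae ?_
    filter_upwards [hx.integrable_deriv.norm.ae_hasDerivAt_integral] with u hu hut
    rw [uIoc_of_le hst] at hut
    have h := hu (by rw [uIcc_of_le hT]; exact ⟨hs.trans hut.1.le, hut.2.trans ht⟩) 0 left_mem_uIcc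
    have h' := (h.const_mul c).exp.deriv
    rw [show (fun u => Real.exp (c * arcLength x u)) =
      fun u => Real.exp (c * ∫ r in (0 : ℝ)..u, ‖deriv x r‖) from rfl, h', arcLength]
    ring
  rw [h2, uIcc_of_le (sub_nonneg.2 (hmono left_mem_uIcc right_mem_uIcc hst))] at h1
  have := h1.2
  have := Real.exp_pos (c * arcLength x s)
  simp only at *
  linarith

end IsPiecewiseDifferentiable

/-! ### Well-posedness of the differential equation -/

namespace IsSolution

variable {T : ℝ} {x : ℝ → E l} {g : Fin l → E d → E d} {s₀ : ℝ} {z : E d} {y : ℝ → E d}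

theorem initial (hs : s₀ ≤ T) (hy : IsSolution g x T s₀ z y) : y s₀ = z := by
  simpa using hy.2 s₀ ⟨le_rfl, hs⟩

theorem sub_eq_integral (hx : IsPiecewiseDifferentiable T x) (hg : ∀ i, Continuous (g i))
    (hs₀ : 0 ≤ s₀) (hy : IsSolution g x T s₀ z y) {s t : ℝ} (hs : s₀ ≤ s) (hst : s ≤ t)
    (ht : t ≤ T) : y t - y s = ∑ i, ∫ u in s..t, deriv x u i • g i (y u) := by
  rw [hy.2 t ⟨hs.trans hst, ht⟩, hy.2 s ⟨hs, hst.trans ht⟩, add_sub_add_left_eq_sub,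
    ← Finset.sum_sub_distrib]
  refine Finset.sum_congr rfl fun i _ => ?_
  have h : ∀ r, s₀ ≤ r → r ≤ T →
      IntervalIntegrable (fun u => deriv x u i • g i (y u)) volume s₀ r :=
    fun r hr hrT => hx.intervalIntegrable_smul i hs₀ hr hrT
      ((hg i).comp_continuousOn (hy.1.mono (Icc_subset_Icc_right hrT)))
  exact intervalIntegral.integral_interval_sub_left (h t (hs.trans hst) ht) (h s hs (hst.trans ht))

theorem restart (hx : IsPiecewiseDifferentiable T x) (hg : ∀ i, Continuous (g i))
    (hs₀ : 0 ≤ s₀) (hy : IsSolution g x T s₀ z y) {s : ℝ} (hs : s₀ ≤ s) :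
    IsSolution g x T s (y s) y :=
  ⟨hy.1.mono (Icc_subset_Icc_left hs), fun t ht => by
    rw [← hy.sub_eq_integral hx hg hs₀ hs ht.1 ht.2, add_sub_cancel]⟩

end IsSolution

/-- Well-posedness of the equation: the Picard map is a contraction in the supremum norm weighted
by `exp (-c ω)`, where `ω` is the arc length of the driving path. The weight is built into the
unknown function, which is `f = exp (-c ω) y`. -/
theorem exists_unique_isSolution {T K : ℝ} {x : ℝ → E l} {g : Fin l → E d → E d}
    (hx : IsPiecewiseDifferentiable T x) (hg : FieldBounds g K) (hK : 1 ≤ K) {s : ℝ} (hs : 0 ≤ s)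
    (hsT : s ≤ T) (z : E d) :
    ∃ y, IsSolution g x T s z y ∧ ∀ y', IsSolution g x T s z y' → EqOn y' y (Icc s T) := by
  have hgc : ∀ i, Continuous (g i) := fun i => (hg.differentiable i).continuous
  -- with this exponent the weighted Picard map has Lipschitz constant `l * K / c ≤ 1 / 2`
  set c : ℝ := 2 * (l * K) + 1 with hc
  have hlK : (0 : ℝ) ≤ l * K := by positivity
  have hc0 : 0 < c := by linarith
  set w : ℝ → ℝ := fun u => Real.exp (c * arcLength x u) with hw
  have hw0 : ∀ u, 0 < w u := fun u => Real.exp_pos _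
  have hwc : ContinuousOn w (Icc s T) :=
    ((hx.continuousOn_arcLength (hs.trans hsT)).mono (Icc_subset_Icc_left hs)).const_mul c |>.rexp
  have hwc' : ContinuousOn (fun u => (w u)⁻¹) (Icc s T) := hwc.inv₀ fun u _ => (hw0 u).ne'
  -- the unweighted path of `f`, and the right-hand side of the integral equation
  set Y : C(Icc s T, E d) → ℝ → E d := fun f u => w u • f (projIcc s T hsT u) with hY
  set P : (ℝ → E d) → ℝ → E d := fun y t => z + ∑ i, ∫ u in s..t, deriv x u i • g i (y u) with hP
  have hYc : ∀ f, ContinuousOn (Y f) (Icc s T) := fun f =>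
    hwc.smul (f.continuous.comp continuous_projIcc).continuousOn
  have hPc : ∀ y, ContinuousOn y (Icc s T) → ContinuousOn (P y) (Icc s T) := by
    intro y hy
    refine continuousOn_const.add (continuousOn_finsetSum _ fun i _ => ?_)
    have h := intervalIntegral.continuousOn_primitive_interval' (hx.intervalIntegrable_smul i hs hsT
      le_rfl ((hgc i).comp_continuousOn hy)) left_mem_uIcc
    rwa [uIcc_of_le hsT] at h
  set Q : C(Icc s T, E d) → C(Icc s T, E d) := fun f =>
    ⟨(Icc s T).domRestrict fun t => (w t)⁻¹ • P (Y f) t,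
      (hwc'.smul (hPc _ (hYc f))).domRestrict⟩ with hQ
  have hQ_apply : ∀ f t (ht : t ∈ Icc s T), Q f ⟨t, ht⟩ = (w t)⁻¹ • P (Y f) t := fun _ _ _ => rfl
  have hcontr : ContractingWith (1 / 2) Q := by
    refine ⟨by rw [← NNReal.coe_lt_coe]; norm_num, LipschitzWith.of_dist_le_mul fun f f' => ?_⟩
    rw [ContinuousMap.dist_le (by positivity)]
    rintro ⟨t, ht⟩
    obtain ⟨hst, htT⟩ := id ht
    have hint : ∀ f i, IntervalIntegrable (fun u => deriv x u i • g i (Y f u)) volume s t :=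
      fun f i => hx.intervalIntegrable_smul i hs hst htT
        ((hgc i).comp_continuousOn ((hYc f).mono (Icc_subset_Icc_right htT)))
    have e : Q f ⟨t, ht⟩ - Q f' ⟨t, ht⟩ =
        (w t)⁻¹ • ∑ i, ∫ u in s..t, deriv x u i • (g i (Y f u) - g i (Y f' u)) := by
      rw [hQ_apply, hQ_apply, ← smul_sub, add_sub_add_left_eq_sub, ← Finset.sum_sub_distrib]
      congr 1
      refine Finset.sum_congr rfl fun i _ => ?_
      rw [← intervalIntegral.integral_sub (hint f i) (hint f' i)]
      simp only [smul_sub]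
    have hi : ∀ i, ‖∫ u in s..t, deriv x u i • (g i (Y f u) - g i (Y f' u))‖ ≤
        K * dist f f' / c * w t := by
      intro i
      have h1 : ‖∫ u in s..t, deriv x u i • (g i (Y f u) - g i (Y f' u))‖ ≤
          ∫ u in s..t, (K * dist f f' / c) * (c * (‖deriv x u‖ * w u)) := by
        refine intervalIntegral.norm_integral_le_of_norm_le hst (ae_of_all _ fun u hu => ?_) ?_
        · have h2 : ‖Y f u - Y f' u‖ ≤ w u * dist f f' := by
            simp only [hY]
            rw [← smul_sub, norm_smul, Real.norm_of_nonneg (hw0 u).le, ← dist_eq_norm]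
            exact mul_le_mul_of_nonneg_left (f.dist_apply_le_dist _) (hw0 u).le
          rw [norm_smul]
          calc _ ≤ ‖deriv x u‖ * (K * (w u * dist f f')) := by
                gcongr
                · exact PiLp.norm_apply_le (deriv x u) i
                · exact ((hg.field i).lip _ _).trans (by gcongr)
            _ = _ := by field_simp
        · refine IntervalIntegrable.const_mul (IntervalIntegrable.const_mul ?_ _) _
          exact ((hx.intervalIntegrable_deriv hs hst htT).norm).mul_continuousOn
            (by rw [uIcc_of_le hst]; exact hwc.mono (Icc_subset_Icc_right htT))
      rw [intervalIntegral.integral_const_mul] at h1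
      refine h1.trans (mul_le_mul_of_nonneg_left
        (hx.integral_norm_deriv_mul_exp_le hc0.le hs hst htT) (by positivity))
    rw [dist_eq_norm, e, norm_smul, norm_inv, Real.norm_of_nonneg (hw0 t).le]
    calc (w t)⁻¹ * ‖∑ i, ∫ u in s..t, deriv x u i • (g i (Y f u) - g i (Y f' u))‖
        ≤ (w t)⁻¹ * (l * (K * dist f f' / c * w t)) := by
          have := hw0 t
          gcongr
          simpa using norm_sum_le_of_le Finset.univ fun i _ => hi i
      _ = (l * K / c) * dist f f' := by field_simp [(hw0 t).ne']
      _ ≤ _ := by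
          gcongr
          rw [div_le_iff₀ hc0]
          push_cast
          linarith
  refine ⟨Y (ContractingWith.fixedPoint Q hcontr), ⟨hYc _, fun t ht => ?_⟩, fun y hy t ht => ?_⟩
  · have h := congrArg (fun f : C(Icc s T, E d) => f ⟨t, ht⟩) (hcontr.fixedPoint_isFixedPt (f := Q))
    simp only [hQ_apply] at h
    change w t • ContractingWith.fixedPoint Q hcontr (projIcc s T hsT t) = _
    rw [projIcc_of_mem hsT ht, ← h]
    exact smul_inv_smul₀ (hw0 t).ne' _
  · set f : C(Icc s T, E d) :=
      ⟨(Icc s T).domRestrict fun t => (w t)⁻¹ • y t, (hwc'.smul hy.1).domRestrict⟩ with hf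
    have hYf : ∀ u ∈ Icc s T, Y f u = y u := by
      intro u hu
      simp only [hY, projIcc_of_mem hsT hu]
      exact smul_inv_smul₀ (hw0 u).ne' _
    have hfix : Q f = f := by
      ext1 ⟨r, hr⟩
      change (w r)⁻¹ • P (Y f) r = (w r)⁻¹ • y r
      rw [hy.2 r hr]
      refine congrArg (fun v => (w r)⁻¹ • (z + v)) (Finset.sum_congr rfl fun i _ => ?_)
      refine intervalIntegral.integral_congr fun u hu => ?_
      rw [uIcc_of_le hr.1] at hu
      simp only [hYf u ⟨hu.1, hu.2.trans hr.2⟩]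
    rw [← hYf t ht, hcontr.fixedPoint_unique hfix]

/-! ### The local error of the Taylor step -/

/-- The increment `Ψ(z; s, t) - z` of the Taylor step. -/
noncomputable def pathIncr (g : Fin l → E d → E d) (x : ℝ → E l) (s t : ℝ) : E d → E d :=
  stepIncr g (fun i => x t i - x s i) (fun i j => iteratedIntegral x i j s t)

theorem taylorStep_eq (g : Fin l → E d → E d) (x : ℝ → E l) (z : E d) (s t : ℝ) :
    taylorStep g x z s t = z + pathIncr g x s t z := by
  rw [taylorStep, pathIncr, stepIncr, add_assoc]

/-- The local error `y_t - Ψ(y_s; s, t)` of the Taylor step along `y`. -/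
noncomputable def localError (g : Fin l → E d → E d) (x : ℝ → E l) (y : ℝ → E d) (s t : ℝ) : E d :=
  y t - (y s + pathIncr g x s t (y s))

/-- The local error is `O(M_{st})`: the second order expansion of `∫ g(y_u) dx_u` leaves integrals of
terms quadratic in the arc length run since time `s`. -/
theorem IsSolution.norm_localError_le {T K : ℝ} {x : ℝ → E l} {g : Fin l → E d → E d}
    (hx : IsPiecewiseDifferentiable T x) (hg : FieldBounds g K) (hK : 1 ≤ K) {s₀ : ℝ} {z : E d}
    {y : ℝ → E d} (hs₀ : 0 ≤ s₀) (hy : IsSolution g x T s₀ z y) {s t : ℝ} (hs : s₀ ≤ s)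
    (hst : s ≤ t) (ht : t ≤ T) :
    ‖localError g x y s t‖ ≤ 2 * (l * K) ^ 3 * (arcLength x t - arcLength x s) ^ 3 := by
  have hgc : ∀ i, Continuous (g i) := fun i => (hg.differentiable i).continuous
  have hs0 := hs₀.trans hs
  set δ := arcLength x t - arcLength x s with hδ
  have hδ0 : 0 ≤ δ := sub_nonneg.2 (hx.arcLength_mono hs0 hst ht)
  have hδu : ∀ u ∈ Icc s t, arcLength x u - arcLength x s ≤ δ := fun u hu =>
    sub_le_sub_right (hx.arcLength_mono (hs0.trans hu.1) hu.2 ht) _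
  have h0 : ∀ u ∈ Icc s t, ‖y u - y s‖ ≤ l * (K * δ) := by
    intro u hu
    rw [hy.sub_eq_integral hx hgc hs₀ hs hu.1 (hu.2.trans ht)]
    refine (norm_sum_le_of_le Finset.univ fun i _ => (hx.norm_integral_smul_le i hs0 hu.1
      (hu.2.trans ht) (B := K) fun r _ => (hg.field i).bound _).trans
      (mul_le_mul_of_nonneg_left (hδu u hu) (by linarith))).trans (by simp)
  have hyc : ContinuousOn y (Icc s t) := hy.1.mono (Icc_subset_Icc hs ht)
  have hint : ∀ i, ∀ u ∈ Icc s t,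
      IntervalIntegrable (fun r => deriv x r i • g i (y r)) volume s u := fun i u hu =>
    hx.intervalIntegrable_smul i hs0 hu.1 (hu.2.trans ht)
      ((hgc i).comp_continuousOn (hyc.mono (Icc_subset_Icc_right hu.2)))
  have hconst : ∀ i, ∀ u ∈ Icc s t, ∀ v : E d,
      ∫ r in s..u, deriv x r i • v = (x u i - x s i) • v := fun i u hu v => by
    rw [intervalIntegral.integral_smul_const, hx.integral_deriv_apply i hs0 hu.1 (hu.2.trans ht)]
  have hconst' : ∀ i, ∀ u ∈ Icc s t, ∀ v : E d,
      IntervalIntegrable (fun r => deriv x r i • v) volume s u := fun i u hu v =>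
    hx.intervalIntegrable_smul i hs0 hu.1 (hu.2.trans ht) continuousOn_const
  have h1 : ∀ u ∈ Icc s t, ‖y u - y s - ∑ i, (x u i - x s i) • g i (y s)‖ ≤
      l * (K * (l * (K * δ)) * δ) := by
    intro u hu
    rw [hy.sub_eq_integral hx hgc hs₀ hs hu.1 (hu.2.trans ht), ← Finset.sum_sub_distrib]
    refine (norm_sum_le_of_le Finset.univ fun i _ => ?_).trans
      (by simp : ∑ _i : Fin l, (K * (l * (K * δ)) * δ) ≤ _)
    rw [← hconst i u hu, ← intervalIntegral.integral_sub (hint i u hu) (hconst' i u hu _)]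
    simp only [← smul_sub]
    refine (hx.norm_integral_smul_le i hs0 hu.1 (hu.2.trans ht) (B := K * (l * (K * δ)))
      fun r hr => ?_).trans (mul_le_mul_of_nonneg_left (hδu u hu) (by positivity))
    exact ((hg.field i).lip _ _).trans
      (mul_le_mul_of_nonneg_left (h0 r ⟨hr.1, hr.2.trans hu.2⟩) (by linarith))
  set φ : Fin l → ℝ → E d := fun j u =>
    g j (y u) - g j (y s) - ∑ i, (x u i - x s i) • dirDeriv g i j (y s) with hφ
  have h2 : ∀ j, ∀ u ∈ Icc s t,
      ‖φ j u‖ ≤ K * (l * (K * δ)) ^ 2 + K * (l * (K * (l * (K * δ)) * δ)) := by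
    intro j u hu
    have e : φ j u = taylorRem (g j) (y s) (y u - y s) +
        fderiv ℝ (g j) (y s) (y u - y s - ∑ i, (x u i - x s i) • g i (y s)) := by
      simp only [hφ, taylorRem, map_sub, map_sum, map_smul, dirDeriv, add_sub_cancel]
      abel
    rw [e]
    refine norm_add_le_of_le ((norm_taylorRem_le (hg.differentiable j) (hg.fderiv j).toBddLip
      _ _).trans ?_) (ContinuousLinearMap.le_of_opNorm_le_of_le _ ((hg.fderiv j).bound _) (h1 u hu))
    gcongr
    exact h0 u hu
  have htt : t ∈ Icc s t := ⟨hst, le_rfl⟩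
  have hxi : ∀ i, ContinuousOn (fun u => x u i - x s i) (Icc s t) := fun i =>
    ((EuclideanSpace.proj (𝕜 := ℝ) i).continuous.comp_continuousOn
      (hx.continuousOn.mono (Icc_subset_Icc hs0 ht))).sub continuousOn_const
  have h3 : localError g x y s t = ∑ j, ∫ u in s..t, deriv x u j • φ j u := by
    have e : ∀ j, ∫ u in s..t, deriv x u j • φ j u =
        (∫ u in s..t, deriv x u j • g j (y u)) - (x t j - x s j) • g j (y s) -
          ∑ i, iteratedIntegral x i j s t • dirDeriv g i j (y s) := by
      intro j
      have hI : ∀ i, IntervalIntegrable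
          (fun u => deriv x u j • (x u i - x s i) • dirDeriv g i j (y s)) volume s t := fun i =>
        hx.intervalIntegrable_smul j hs0 hst ht ((hxi i).smul continuousOn_const)
      simp only [hφ, smul_sub, Finset.smul_sum]
      rw [intervalIntegral.integral_sub, intervalIntegral.integral_sub (hint j t htt)
        (hconst' j t htt _), hconst j t htt, intervalIntegral.integral_finsetSum, sub_right_inj]
      · refine Finset.sum_congr rfl fun i _ => ?_
        rw [iteratedIntegral, ← intervalIntegral.integral_smul_const]
        simp only [smul_smul, mul_comm]
      · exact fun i _ => hI i
      · exact (hint j t htt).sub (hconst' j t htt _)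
      · have := IntervalIntegrable.sum Finset.univ (fun i _ => hI i)
        simpa only [Finset.sum_fn] using this
    simp only [e, Finset.sum_sub_distrib]
    rw [← hy.sub_eq_integral hx hgc hs₀ hs hst ht, localError, pathIncr, stepIncr,
      Finset.sum_comm (f := fun i j => iteratedIntegral x i j s t • dirDeriv g i j (y s))]
    abel
  rw [h3]
  refine (norm_sum_le_of_le Finset.univ fun j _ =>
    hx.norm_integral_smul_le j hs0 hst ht (h2 j)).trans (le_of_eq ?_)
  simp only [Finset.sum_const, Finset.card_univ, Fintype.card_fin, nsmul_eq_mul, ← hδ]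
  ring

/-! ### Rough path bounds -/

/-- The increments of `x` and of its iterated integrals are bounded by `N |t - s| ^ γ` and
`N |t - s| ^ (2 γ)`. -/
structure RoughBound (T γ N : ℝ) (x : ℝ → E l) : Prop where
  incr : ∀ i s t, 0 ≤ s → s ≤ t → t ≤ T → |x t i - x s i| ≤ N * (t - s) ^ γ
  area : ∀ i j s t, 0 ≤ s → s ≤ t → t ≤ T → |iteratedIntegral x i j s t| ≤ N * ((t - s) ^ γ) ^ 2

theorem le_sSup_holderQuotients_mul {T μ : ℝ} {f : ℝ → ℝ → ℝ}
    (hf : BddAbove (holderQuotients T μ f)) {s t : ℝ} (hs : 0 ≤ s) (hst : s < t) (ht : t ≤ T) :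
    f s t ≤ sSup (holderQuotients T μ f) * (t - s) ^ μ := by
  have h := le_csSup hf ⟨s, t, hs, hst, ht, rfl⟩
  rw [abs_of_pos (sub_pos.2 hst)] at h
  rwa [div_le_iff₀ (Real.rpow_pos_of_pos (sub_pos.2 hst) _)] at h

theorem abs_iteratedIntegral_le_areaNorm (x : ℝ → E l) (i j : Fin l) (s t : ℝ) :
    |iteratedIntegral x i j s t| ≤ areaNorm x s t := by
  rw [← Real.sqrt_sq_eq_abs]
  refine Real.sqrt_le_sqrt ?_
  exact (Finset.single_le_sum (f := fun j => iteratedIntegral x i j s t ^ 2)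
    (fun _ _ => sq_nonneg _) (Finset.mem_univ j)).trans
    (Finset.single_le_sum (f := fun i => ∑ j, iteratedIntegral x i j s t ^ 2)
      (fun _ _ => Finset.sum_nonneg fun _ _ => sq_nonneg _) (Finset.mem_univ i))

theorem HasFiniteRoughNorm.roughBound {T γ N : ℝ} {x : ℝ → E l} (hγ : 0 < γ)
    (hx : HasFiniteRoughNorm T γ x) (hN : roughNorm T γ x ≤ N) : RoughBound T γ N x := by
  have h1 : 0 ≤ sSup (holderQuotients T γ fun s t => ‖x t - x s‖) :=
    Real.sSup_nonneg (by rintro _ ⟨s, t, _, _, _, rfl⟩; positivity)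
  have h2 : 0 ≤ sSup (holderQuotients T (2 * γ) fun s t => areaNorm x s t) :=
    Real.sSup_nonneg (by
      rintro _ ⟨s, t, _, _, _, rfl⟩
      exact div_nonneg (Real.sqrt_nonneg _) (by positivity))
  rw [roughNorm] at hN
  refine ⟨fun i s t hs hst ht => ?_, fun i j s t hs hst ht => ?_⟩
  · rcases hst.eq_or_lt with rfl | hst
    · simp [Real.zero_rpow hγ.ne']
    · refine (PiLp.norm_apply_le (x t - x s) i).trans
        ((le_sSup_holderQuotients_mul hx.1 hs hst ht).trans ?_)
      have := sub_pos.2 hst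
      gcongr
      linarith
  · rcases hst.eq_or_lt with rfl | hst
    · simp [iteratedIntegral, Real.zero_rpow hγ.ne']
    · refine (abs_iteratedIntegral_le_areaNorm x i j s t).trans
        ((le_sSup_holderQuotients_mul hx.2 hs hst ht).trans ?_)
      have := sub_pos.2 hst
      have e : (t - s) ^ (2 * γ) = ((t - s) ^ γ) ^ 2 := by
        rw [mul_comm, Real.rpow_mul this.le, Real.rpow_two]
      rw [e]
      gcongr
      linarith

theorem RoughBound.bddLip2_pathIncr {T γ N K : ℝ} {x : ℝ → E l} {g : Fin l → E d → E d}
    (hx : RoughBound T γ N x) (hγ : 0 < γ) (hN : 0 ≤ N) (hg : FieldBounds g K) {s t : ℝ}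
    (hs : 0 ≤ s) (hst : s ≤ t) (ht : t ≤ T) (h1 : t - s ≤ 1) :
    BddLip2 (pathIncr g x s t) ((l + l * l) * (N * K) * (t - s) ^ γ) := by
  have hX0 : 0 ≤ (t - s) ^ γ := Real.rpow_nonneg (by linarith) γ
  have hX1 : (t - s) ^ γ ≤ 1 := Real.rpow_le_one (by linarith) h1 hγ.le
  refine (bddLip2_stepIncr hg (fun i => hx.incr i s t hs hst ht) fun i j =>
    (hx.area i j s t hs hst ht).trans (mul_le_mul_of_nonneg_left ?_ hN)).mono (le_of_eq ?_)
  · nlinarith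
  · ring

/-- The defect `Ψ_{ut} ∘ Ψ_{su} - Ψ_{st}` of the flow property of the Taylor step is of order `3 γ`,
uniformly over paths of bounded rough norm. -/
theorem exists_bddLip_pathIncr_defect {γ N K T : ℝ} {g : Fin l → E d → E d} (hγ : 0 < γ)
    (hN : 0 ≤ N) (hg : FieldBounds g K) : ∃ C, 0 ≤ C ∧ ∀ x : ℝ → E l,
      IsPiecewiseDifferentiable T x → RoughBound T γ N x → ∀ s u t, 0 ≤ s → s ≤ u → u ≤ t → t ≤ T →
      t - s ≤ 1 → BddLip (fun z => pathIncr g x s u z + pathIncr g x u t (z + pathIncr g x s u z) -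
        pathIncr g x s t z) (C * ((t - s) ^ γ) ^ 3) := by
  obtain ⟨C, hC, H⟩ := exists_bddLip_stepIncr_defect hg hN
  refine ⟨C, hC, fun x hx hxr s u t hs hsu hut ht h1 => ?_⟩
  have hsu' : (u - s) ^ γ ≤ (t - s) ^ γ := Real.rpow_le_rpow (by linarith) (by linarith) hγ.le
  have hut' : (t - u) ^ γ ≤ (t - s) ^ γ := Real.rpow_le_rpow (by linarith) (by linarith) hγ.le
  have hsu0 : 0 ≤ (u - s) ^ γ := Real.rpow_nonneg (by linarith) γ
  have hut0 : 0 ≤ (t - u) ^ γ := Real.rpow_nonneg (by linarith) γ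
  have hu0 := hs.trans hsu
  have huT := hut.trans ht
  exact H _ _ _ _ _ _ _ (Real.rpow_nonneg (by linarith) γ)
    (Real.rpow_le_one (by linarith) h1 hγ.le)
    (fun i => (hxr.incr i s u hs hsu huT).trans (by gcongr))
    (fun i => (hxr.incr i u t hu0 hut ht).trans (by gcongr))
    (fun i j => (hxr.area i j s u hs hsu huT).trans (by gcongr))
    (fun i j => (hxr.area i j u t hu0 hut ht).trans (by gcongr))
    (fun i => by ring)
    (fun i j => hx.iteratedIntegral_chen i j hs hsu hut ht)

/-- On short intervals the cube of the arc length is negligible against the arc length. -/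
theorem IsPiecewiseDifferentiable.exists_cube_le {T : ℝ} {x : ℝ → E l}
    (hx : IsPiecewiseDifferentiable T x) (hT : 0 ≤ T) {C : ℝ} (hC : 0 ≤ C) {ε : ℝ} (hε : 0 < ε) :
    ∃ η > 0, ∀ s t, 0 ≤ s → s ≤ t → t ≤ T → t - s ≤ η →
      C * (arcLength x t - arcLength x s) ^ 3 ≤ ε * (arcLength x t - arcLength x s) := by
  have hu := isCompact_Icc.uniformContinuousOn_of_continuous (hx.continuousOn_arcLength hT)
  obtain ⟨η, hη, H⟩ := Metric.uniformContinuousOn_iff.1 hu (min 1 (ε / (C + 1))) (by positivity)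
  refine ⟨η / 2, by positivity, fun s t hs hst ht hr => ?_⟩
  have h := H t ⟨hs.trans hst, ht⟩ s ⟨hs, hst.trans ht⟩
    (by rw [Real.dist_eq, abs_of_nonneg (by linarith)]; linarith)
  have h0 := sub_nonneg.2 (hx.arcLength_mono hs hst ht)
  rw [Real.dist_eq, abs_of_nonneg h0] at h
  generalize arcLength x t - arcLength x s = δ at *
  have h1 : δ ≤ 1 := (h.trans_le (min_le_left _ _)).le
  have h2 : δ ≤ ε / (C + 1) := (h.trans_le (min_le_right _ _)).le
  rw [le_div_iff₀ (by linarith)] at h2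
  have h3 : C * δ ^ 2 ≤ ε := by nlinarith
  calc C * δ ^ 3 = C * δ ^ 2 * δ := by ring
    _ ≤ ε * δ := by gcongr

/-! ### Uniform local error and Lipschitz dependence on the initial value -/

/-- How the local error over `[s, t]` is built from those over `[s, u]` and `[u, t]`. -/
theorem localError_split (g : Fin l → E d → E d) (x : ℝ → E l) (y : ℝ → E d) (s u t : ℝ) :
    localError g x y s t = localError g x y u t + localError g x y s u +
      (pathIncr g x u t ((y s + pathIncr g x s u (y s)) + localError g x y s u) -
        pathIncr g x u t (y s + pathIncr g x s u (y s))) +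
      (pathIncr g x s u (y s) + pathIncr g x u t (y s + pathIncr g x s u (y s)) -
        pathIncr g x s t (y s)) := by
  have e : (y s + pathIncr g x s u (y s)) + localError g x y s u = y u := by
    rw [localError, add_sub_cancel]
  rw [e]
  simp only [localError]
  abel

theorem rpow_mul_three {r γ : ℝ} (hr : 0 ≤ r) : r ^ (γ * 3) = (r ^ γ) ^ 3 := by
  rw [Real.rpow_mul hr]
  exact_mod_cast Real.rpow_natCast (r ^ γ) 3

/-- Davie's estimate: the local error of the Taylor step is of order `3 γ`, with a constant that
depends on the driving path only through its rough norm. -/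
theorem exists_localError_le {γ N K T : ℝ} {g : Fin l → E d → E d} (hγ : 1 / 3 < γ) (hN : 0 ≤ N)
    (hK : 1 ≤ K) (hg : FieldBounds g K) : ∃ h C, 0 < h ∧ h ≤ 1 ∧ 0 ≤ C ∧ ∀ x : ℝ → E l,
      IsPiecewiseDifferentiable T x → RoughBound T γ N x →
      ∀ (s₀ : ℝ) (z : E d) (y : ℝ → E d), 0 ≤ s₀ → IsSolution g x T s₀ z y →
      ∀ s t, s₀ ≤ s → s ≤ t → t ≤ T → t - s ≤ h →
        ‖localError g x y s t‖ ≤ C * ((t - s) ^ γ) ^ 3 := by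
  have hγ0 : 0 < γ := by linarith
  obtain ⟨D, hD, hdef⟩ := exists_bddLip_pathIncr_defect (T := T) hγ0 hN hg
  set A : ℝ := (l + l * l) * (N * K) with hA
  have hA0 : 0 ≤ A := by positivity
  obtain ⟨h, C, h0, h1, hC, H⟩ := exists_sewing_bound hA0 hγ0 (θ := γ * 3) (by linarith)
  refine ⟨h, C * D, h0, h1, by positivity, fun x hx hxr s₀ z y hs₀ hy s t hs hst ht hr => ?_⟩
  have hT : 0 ≤ T := by linarith
  have key := H (fun s t => ‖localError g x y s t‖) (arcLength x) s₀ T D hD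
    (fun a ha b hb hab => hx.arcLength_mono (hs₀.trans ha.1) hab hb.2) ?_ ?_ s t hs hst ht hr
  · rwa [rpow_mul_three (sub_nonneg.2 hst)] at key
  · intro s t hs hst ht hr
    have hs0 := hs₀.trans hs
    have hsu : s ≤ (s + t) / 2 := by linarith
    have hut : (s + t) / 2 ≤ t := by linarith
    rw [rpow_mul_three (sub_nonneg.2 hst)]
    have hX : (t - (s + t) / 2) ^ γ ≤ (t - s) ^ γ :=
      Real.rpow_le_rpow (by linarith) (by linarith) hγ0.le
    have hX0 : 0 ≤ (t - s) ^ γ := Real.rpow_nonneg (by linarith) γ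
    have e1 := ((hxr.bddLip2_pathIncr hγ0 hN hg (hs0.trans hsu) hut ht (by linarith)).lip
      ((y s + pathIncr g x s ((s + t) / 2) (y s)) + localError g x y s ((s + t) / 2))
      (y s + pathIncr g x s ((s + t) / 2) (y s)))
    have e2 := (hdef x hx hxr s _ t hs0 hsu hut ht (by linarith)).bound (y s)
    rw [add_sub_cancel_left] at e1
    rw [localError_split g x y s ((s + t) / 2) t]
    have e3 : A * (t - (s + t) / 2) ^ γ * ‖localError g x y s ((s + t) / 2)‖ ≤
        A * (t - s) ^ γ * ‖localError g x y s ((s + t) / 2)‖ := by gcongr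
    have e4 : 0 ≤ A * (t - s) ^ γ * ‖localError g x y ((s + t) / 2) t‖ := by positivity
    refine (norm_add_le_of_le (norm_add_le_of_le (norm_add_le _ _) (e1.trans e3)) e2).trans ?_
    linarith
  · intro ε hε
    obtain ⟨η, hη, hη'⟩ := hx.exists_cube_le hT (C := 2 * (l * K) ^ 3) (by positivity) hε
    exact ⟨η, hη, fun s t hs hst ht hr =>
      (hy.norm_localError_le hx hg hK hs₀ hs hst ht).trans (hη' s t (hs₀.trans hs) hst ht hr)⟩

/-- The difference of two solutions over short intervals. The difference of the two local errors
satisfies the hypotheses of the sewing estimate, with an error term proportional to the largest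
distance `S` of the solutions; on a short interval the resulting bound gives back `S` in terms of
the initial distance. -/
theorem exists_norm_solution_sub_le_local {γ N K T : ℝ} {g : Fin l → E d → E d} (hγ : 1 / 3 < γ)
    (hN : 0 ≤ N) (hK : 1 ≤ K) (hg : FieldBounds g K) : ∃ h B, 0 < h ∧ h ≤ 1 ∧ 0 ≤ B ∧
      ∀ x : ℝ → E l, IsPiecewiseDifferentiable T x → RoughBound T γ N x →
      ∀ (s₀ : ℝ) (z z' : E d) (y y' : ℝ → E d), 0 ≤ s₀ →
      IsSolution g x T s₀ z y → IsSolution g x T s₀ z' y' →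
      ∀ a b, s₀ ≤ a → a ≤ b → b ≤ T → b - a ≤ h →
        ‖(y b - y' b) - (y a - y' a)‖ ≤ B * (b - a) ^ γ * ‖y a - y' a‖ := by
  have hγ0 : 0 < γ := by linarith
  obtain ⟨D, hD, hdef⟩ := exists_bddLip_pathIncr_defect (T := T) hγ0 hN hg
  obtain ⟨h₁, C₁, h₁0, h₁1, hC₁, hloc⟩ := exists_localError_le (T := T) hγ hN hK hg
  set A : ℝ := (l + l * l) * (N * K) with hA
  have hA0 : 0 ≤ A := by positivity
  obtain ⟨h₂, C₂, h₂0, h₂1, hC₂, H⟩ := exists_sewing_bound hA0 hγ0 (θ := γ * 3) (by linarith)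
  set D' : ℝ := A * C₁ * (1 + A) + D with hD'
  have hD'0 : 0 ≤ D' := by positivity
  obtain ⟨h₃, h₃0, h₃1, hsmall⟩ :=
    exists_pos_mul_rpow_le (C₂ * D' + A) hγ0 (δ := 1 / 2) (by norm_num)
  refine ⟨min h₁ (min h₂ h₃), 2 * (C₂ * D') + A, by positivity,
    (min_le_left _ _).trans h₁1, by positivity,
    fun x hx hxr s₀ z z' y y' hs₀ hy hy' a b ha hab hb hr => ?_⟩
  have hr₁ : b - a ≤ h₁ := hr.trans (min_le_left _ _)
  have hr₂ : b - a ≤ h₂ := hr.trans ((min_le_right _ _).trans (min_le_left _ _))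
  have hr₃ : b - a ≤ h₃ := hr.trans ((min_le_right _ _).trans (min_le_right _ _))
  have hT : 0 ≤ T := by linarith
  have ha0 := hs₀.trans ha
  have hcont : ContinuousOn (fun t => ‖y t - y' t‖) (Icc a b) :=
    ((hy.1.mono (Icc_subset_Icc ha hb)).sub (hy'.1.mono (Icc_subset_Icc ha hb))).norm
  obtain ⟨τ, hτ, hmax⟩ := isCompact_Icc.exists_isMaxOn (nonempty_Icc.2 hab) hcont
  set S := ‖y τ - y' τ‖ with hS
  have hS0 : 0 ≤ S := norm_nonneg _
  have hmax' : ∀ t ∈ Icc a b, ‖y t - y' t‖ ≤ S := fun t ht => hmax ht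
  have key := H (fun s t => ‖localError g x y s t - localError g x y' s t‖) (arcLength x) a b
    (D' * S) (by positivity)
    (fun p hp q hq hpq => hx.arcLength_mono (ha0.trans hp.1) hpq (hq.2.trans hb)) ?_ ?_
  rotate_left
  · intro s t hs hst ht hr
    have hs0 := ha0.trans hs
    have htT := ht.trans hb
    have hsu : s ≤ (s + t) / 2 := by linarith
    have hut : (s + t) / 2 ≤ t := by linarith
    rw [rpow_mul_three (sub_nonneg.2 hst)]
    set u := (s + t) / 2 with hu
    have hX : (t - u) ^ γ ≤ (t - s) ^ γ := Real.rpow_le_rpow (by linarith) (by linarith) hγ0.le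
    have hX' : (u - s) ^ γ ≤ (t - s) ^ γ := Real.rpow_le_rpow (by linarith) (by linarith) hγ0.le
    have hX'0 : 0 ≤ (u - s) ^ γ := Real.rpow_nonneg (by linarith) γ
    have hX0 : 0 ≤ (t - s) ^ γ := Real.rpow_nonneg (by linarith) γ
    have hX1 : (t - s) ^ γ ≤ 1 := Real.rpow_le_one (by linarith) (by linarith) hγ0.le
    have hss : ‖y s - y' s‖ ≤ S := hmax' s ⟨hs, hst.trans ht⟩
    -- the points reached by the Taylor step from `y s` and from `y' s`
    set w := y s + pathIncr g x s u (y s) with hw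
    set w' := y' s + pathIncr g x s u (y' s) with hw'
    have hww : ‖w - w'‖ ≤ (1 + A) * S := by
      have h1 := (hxr.bddLip2_pathIncr hγ0 hN hg hs0 hsu (hut.trans htT) (by linarith)).lip
        (y s) (y' s)
      have h2 : A * (u - s) ^ γ * ‖y s - y' s‖ ≤ A * 1 * S := by
        gcongr
        exact hX'.trans hX1
      rw [hw, hw', add_sub_add_comm]
      refine (norm_add_le_of_le hss (h1.trans h2)).trans (le_of_eq ?_)
      ring
    have he : ‖localError g x y s u‖ ≤ C₁ * ((t - s) ^ γ) ^ 3 :=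
      (hloc x hx hxr s₀ z y hs₀ hy s u (ha.trans hs) hsu (hut.trans htT) (by linarith)).trans
        (by gcongr)
    have e1 := (hxr.bddLip2_pathIncr hγ0 hN hg (hs0.trans hsu) hut htT (by linarith)).lip2'
      w w' (localError g x y s u) (localError g x y' s u)
    have e2 := (hdef x hx hxr s u t hs0 hsu hut htT (by linarith)).lip (y s) (y' s)
    rw [localError_split g x y s u t, localError_split g x y' s u t, ← hw, ← hw']
    set e := localError g x y s u with hedef
    set e' := localError g x y' s u with he'def
    have e3 : A * (t - u) ^ γ * (‖e‖ * ‖w - w'‖ + ‖e - e'‖) ≤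
        A * (t - s) ^ γ * ((C₁ * ((t - s) ^ γ) ^ 3) * ((1 + A) * S) + ‖e - e'‖) := by gcongr
    have e4 : D * ((t - s) ^ γ) ^ 3 * ‖y s - y' s‖ ≤ D * ((t - s) ^ γ) ^ 3 * S := by gcongr
    have e5 : 0 ≤ A * (t - s) ^ γ * ‖localError g x y u t - localError g x y' u t‖ := by positivity
    have e6 : (t - s) ^ γ * (A * C₁ * (1 + A) * ((t - s) ^ γ) ^ 3 * S) ≤
        1 * (A * C₁ * (1 + A) * ((t - s) ^ γ) ^ 3 * S) := by gcongr
    rw [add_sub_add_comm, add_sub_add_comm, add_sub_add_comm (localError g x y u t)]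
    refine (norm_add_le_of_le (norm_add_le_of_le (norm_add_le _ _) (e1.trans e3))
      (e2.trans e4)).trans ?_
    rw [hD']
    linarith
  · intro ε hε
    obtain ⟨η, hη, hη'⟩ := hx.exists_cube_le hT (C := 2 * (2 * (l * K) ^ 3)) (by positivity) hε
    refine ⟨η, hη, fun s t hs hst ht hr => ?_⟩
    have i1 := hy.norm_localError_le hx hg hK hs₀ (ha.trans hs) hst (ht.trans hb)
    have i2 := hy'.norm_localError_le hx hg hK hs₀ (ha.trans hs) hst (ht.trans hb)
    refine (norm_sub_le_of_le i1 i2).trans (le_trans (le_of_eq ?_)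
      (hη' s t (ha0.trans hs) hst (ht.trans hb) hr))
    ring
  -- the increment of the difference from the left end `a`
  have hincr : ∀ t ∈ Icc a b, ‖(y t - y' t) - (y a - y' a)‖ ≤
      (t - a) ^ γ * (C₂ * D' * S + A * ‖y a - y' a‖) := by
    intro t ht
    have k := key a t le_rfl ht.1 ht.2 (by linarith [ht.2])
    rw [rpow_mul_three (sub_nonneg.2 ht.1)] at k
    have hX0 : 0 ≤ (t - a) ^ γ := Real.rpow_nonneg (by linarith [ht.1]) γ
    have hX1 : (t - a) ^ γ ≤ 1 :=
      Real.rpow_le_one (by linarith [ht.1]) (by linarith [ht.2]) hγ0.le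
    have hl := (hxr.bddLip2_pathIncr hγ0 hN hg ha0 ht.1 (ht.2.trans hb) (by linarith [ht.2])).lip
      (y a) (y' a)
    have e : (y t - y' t) - (y a - y' a) = (localError g x y a t - localError g x y' a t) +
        (pathIncr g x a t (y a) - pathIncr g x a t (y' a)) := by
      simp only [localError]; abel
    have hc : ((t - a) ^ γ) ^ 3 ≤ (t - a) ^ γ := pow_le_of_le_one hX0 hX1 (by norm_num)
    have hc' : C₂ * (D' * S) * ((t - a) ^ γ) ^ 3 ≤ C₂ * (D' * S) * (t - a) ^ γ := by gcongr
    rw [e]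
    refine (norm_add_le_of_le (k.trans hc') hl).trans (le_of_eq ?_)
    ring
  have hSa : S ≤ 2 * ‖y a - y' a‖ := by
    have i1 := hincr τ hτ
    have i2 : ‖y a - y' a‖ ≤ S := hmax' a ⟨le_rfl, hab⟩
    have i3 := hsmall (τ - a) (by linarith [hτ.1]) (by linarith [hτ.2])
    have i4 : S ≤ ‖(y τ - y' τ) - (y a - y' a)‖ + ‖y a - y' a‖ := by
      simpa using norm_add_le ((y τ - y' τ) - (y a - y' a)) (y a - y' a)
    have hX0 : 0 ≤ (τ - a) ^ γ := Real.rpow_nonneg (by linarith [hτ.1]) γ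
    have i5 : (τ - a) ^ γ * (C₂ * D' * S + A * ‖y a - y' a‖) ≤
        (τ - a) ^ γ * (C₂ * D' * S + A * S) := by gcongr
    have i6 := mul_le_mul_of_nonneg_right i3 hS0
    linarith
  refine (hincr b ⟨hab, le_rfl⟩).trans ?_
  have hX0 : 0 ≤ (b - a) ^ γ := Real.rpow_nonneg (by linarith) γ
  calc (b - a) ^ γ * (C₂ * D' * S + A * ‖y a - y' a‖)
      ≤ (b - a) ^ γ * (C₂ * D' * (2 * ‖y a - y' a‖) + A * ‖y a - y' a‖) := by gcongr
    _ = _ := by ring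

/-- The flow minus the identity is Lipschitz in the initial value, with a constant of order `γ` in
time that depends on the driving path only through its rough norm. -/
theorem exists_norm_solution_sub_le {γ N K T : ℝ} {g : Fin l → E d → E d} (hγ : 1 / 3 < γ)
    (hN : 0 ≤ N) (hK : 1 ≤ K) (hg : FieldBounds g K) : ∃ C, 0 ≤ C ∧
      ∀ x : ℝ → E l, IsPiecewiseDifferentiable T x → RoughBound T γ N x →
      ∀ (s₀ : ℝ) (z z' : E d) (y y' : ℝ → E d), 0 ≤ s₀ →
      IsSolution g x T s₀ z y → IsSolution g x T s₀ z' y' →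
      ∀ a b, s₀ ≤ a → a ≤ b → b ≤ T →
        ‖(y b - y' b) - (y a - y' a)‖ ≤ C * (b - a) ^ γ * ‖y a - y' a‖ := by
  obtain ⟨h, B, h0, h1, hB, H⟩ := exists_norm_solution_sub_le_local (T := T) hγ hN hK hg
  obtain ⟨C, hC, H'⟩ := exists_norm_sub_le_of_local (T := T) (γ := γ) (by linarith) hB h0 h1
  refine ⟨C, hC, fun x hx hxr s₀ z z' y y' hs₀ hy hy' a b ha hab hb => ?_⟩
  exact H' (fun t => y t - y' t) a (hs₀.trans ha)
    (fun s t hs hst ht hr => H x hx hxr s₀ z z' y y' hs₀ hy hy' s t (ha.trans hs) hst ht hr)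
    b hab hb

/-! ### The global error -/

theorem IsSolution.flow_eq {T K : ℝ} {x : ℝ → E l} {g : Fin l → E d → E d}
    (hx : IsPiecewiseDifferentiable T x) (hg : FieldBounds g K) (hK : 1 ≤ K) {s : ℝ} (hs : 0 ≤ s)
    {z : E d} {y : ℝ → E d} (hy : IsSolution g x T s z y) {t : ℝ} (ht : t ∈ Icc s T) :
    flow g x T z s t = y t := by
  have h : ∃ y, IsSolution g x T s z y := ⟨y, hy⟩
  obtain ⟨y₀, _, hy₀⟩ := exists_unique_isSolution hx hg hK hs (ht.1.trans ht.2) z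
  rw [flow, dif_pos h, hy₀ _ h.choose_spec ht, hy₀ _ hy ht]

theorem gridPoint_mono {T : ℝ} (hT : 0 ≤ T) (n : ℕ) {j k : ℕ} (hjk : j ≤ k) :
    gridPoint T n j ≤ gridPoint T n k := by
  simp only [gridPoint]
  gcongr

theorem gridPoint_nonneg {T : ℝ} (hT : 0 ≤ T) (n k : ℕ) : 0 ≤ gridPoint T n k := by
  simp only [gridPoint]
  positivity

theorem gridPoint_le {T : ℝ} (hT : 0 ≤ T) {n k : ℕ} (hk : k ≤ n) : gridPoint T n k ≤ T := by
  refine (gridPoint_mono hT n hk).trans ?_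
  rcases Nat.eq_zero_or_pos n with rfl | hn
  · simpa [gridPoint] using hT
  · rw [gridPoint]
    field_simp
    exact le_rfl

/-- The global error, by telescoping over the solutions `Y k` that start at the points of the
scheme: `Y k` and `Y (k + 1)` differ at time `t_{k+1}` by a local error, which the flow propagates
with a bounded factor. -/
theorem exists_gridError_le {γ N T : ℝ} {g : Fin l → E d → E d} (hγ : 1 / 3 < γ) (hT : 0 ≤ T)
    (hg : ∀ i, IsC3b (g i)) (hN : 0 ≤ N) : ∃ C, 0 ≤ C ∧ ∀ x : ℝ → E l,
      IsPiecewiseDifferentiable T x → RoughBound T γ N x →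
      ∀ (a : E d) (n p q : ℕ), p ≤ q → q ≤ n →
        ‖gridError g x T n a q‖ ≤
            C * ∑ k ∈ Finset.range q, M x (gridPoint T n k) (gridPoint T n (k + 1)) ∧
          ‖gridError g x T n a q - gridError g x T n a p‖ ≤
            C * (∑ k ∈ Finset.Ico p q, M x (gridPoint T n k) (gridPoint T n (k + 1)) +
              |gridPoint T n q - gridPoint T n p| ^ γ *
                ∑ k ∈ Finset.range p, M x (gridPoint T n k) (gridPoint T n (k + 1))) := by
  obtain ⟨K, hK, hgK⟩ := exists_fieldBounds hg
  have hgc : ∀ i, Continuous (g i) := fun i => (hgK.differentiable i).continuous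
  obtain ⟨C₂, hC₂, hlip⟩ := exists_norm_solution_sub_le (T := T) hγ hN hK hgK
  set C₁ : ℝ := 2 * (l * K) ^ 3 with hC₁
  have hC₁0 : 0 ≤ C₁ := by positivity
  set L : ℝ := (1 + C₂ * T ^ γ) * C₁ with hL
  have hL0 : 0 ≤ L := by positivity
  refine ⟨(1 + C₂) * L, by positivity, fun x hx hxr a n => ?_⟩
  set τ : ℕ → ℝ := gridPoint T n with hτ
  set Z : ℕ → E d := taylorScheme g x T n a with hZ
  have hτ0 : ∀ k, 0 ≤ τ k := gridPoint_nonneg hT n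
  have hτT : ∀ k ≤ n, τ k ≤ T := fun k hk => gridPoint_le hT hk
  have hτm : ∀ j k, j ≤ k → τ j ≤ τ k := fun j k hjk => gridPoint_mono hT n hjk
  have hM0 : ∀ k, 0 ≤ M x (τ k) (τ (k + 1)) := fun k => by rw [M]; positivity
  have hex : ∀ k, ∃ y, k ≤ n → IsSolution g x T (τ k) (Z k) y := by
    intro k
    by_cases hk : k ≤ n
    · obtain ⟨y, hy, _⟩ := exists_unique_isSolution hx hgK hK (hτ0 k) (hτT k hk) (Z k)
      exact ⟨y, fun _ => hy⟩
    · exact ⟨0, fun h => absurd h hk⟩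
  choose Y hY using hex
  have hsol : ∀ k, k + 1 ≤ n → IsSolution g x T (τ (k + 1)) (Y k (τ (k + 1))) (Y k) := fun k hk =>
    (hY k (by omega)).restart hx hgc (hτ0 k) (hτm k (k + 1) (by omega))
  have hstart : ∀ k, k + 1 ≤ n →
      ‖Y k (τ (k + 1)) - Y (k + 1) (τ (k + 1))‖ ≤ C₁ * M x (τ k) (τ (k + 1)) := by
    intro k hk
    have h := (hY k (by omega)).norm_localError_le hx hgK hK (hτ0 k) le_rfl
      (hτm k (k + 1) (by omega)) (hτT _ hk)
    rw [← hx.M_eq (hτ0 k) (hτm k (k + 1) (by omega)) (hτT _ hk), localError,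
      (hY k (by omega)).initial (hτT _ (by omega)), ← taylorStep_eq] at h
    rwa [(hY (k + 1) hk).initial (hτT _ hk)]
  have hdiff : ∀ k j, k + 1 ≤ j → j ≤ n →
      ‖Y k (τ j) - Y (k + 1) (τ j)‖ ≤ L * M x (τ k) (τ (k + 1)) := by
    intro k j hkj hj
    have hk : k + 1 ≤ n := hkj.trans hj
    have h := hlip x hx hxr _ _ _ _ _ (hτ0 (k + 1)) (hsol k hk) (hY (k + 1) hk) _ (τ j) le_rfl
      (hτm _ _ hkj) (hτT j hj)
    have h1 := norm_add_le ((Y k (τ j) - Y (k + 1) (τ j)) -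
      (Y k (τ (k + 1)) - Y (k + 1) (τ (k + 1)))) (Y k (τ (k + 1)) - Y (k + 1) (τ (k + 1)))
    rw [sub_add_cancel] at h1
    have h2 : (τ j - τ (k + 1)) ^ γ ≤ T ^ γ :=
      Real.rpow_le_rpow (sub_nonneg.2 (hτm _ _ hkj)) (by linarith [hτ0 (k + 1), hτT j hj])
        (by linarith)
    calc ‖Y k (τ j) - Y (k + 1) (τ j)‖
        ≤ (1 + C₂ * (τ j - τ (k + 1)) ^ γ) * ‖Y k (τ (k + 1)) - Y (k + 1) (τ (k + 1))‖ := by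
          linarith
      _ ≤ (1 + C₂ * T ^ γ) * (C₁ * M x (τ k) (τ (k + 1))) := by
          gcongr
          exact hstart k hk
      _ = _ := by ring
  have herr : ∀ j ≤ n, gridError g x T n a j =
      ∑ k ∈ Finset.range j, (Y k (τ j) - Y (k + 1) (τ j)) := by
    intro j hj
    have h0 : τ 0 = 0 := by simp [hτ, gridPoint]
    have hY0 := hY 0 (Nat.zero_le n)
    rw [h0] at hY0
    change IsSolution g x T 0 a (Y 0) at hY0
    change flow g x T a 0 (τ j) - Z j = _
    rw [Finset.sum_range_sub' (fun k => Y k (τ j)),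
      hY0.flow_eq hx hgK hK le_rfl ⟨hτ0 j, hτT j hj⟩, (hY j hj).initial (hτT j hj)]
  intro p q hpq hqn
  constructor
  · rw [herr q hqn, Finset.mul_sum]
    refine norm_sum_le_of_le _ fun k hk => (hdiff k q (Finset.mem_range.1 hk) hqn).trans ?_
    have := hM0 k
    gcongr
    nlinarith
  · have hsub : gridError g x T n a q - gridError g x T n a p =
        ∑ k ∈ Finset.range p,
          ((Y k (τ q) - Y (k + 1) (τ q)) - (Y k (τ p) - Y (k + 1) (τ p))) +
        ∑ k ∈ Finset.Ico p q, (Y k (τ q) - Y (k + 1) (τ q)) := by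
      rw [herr q hqn, herr p (hpq.trans hqn), ← Finset.sum_range_add_sum_Ico _ hpq,
        Finset.sum_sub_distrib (fun k => Y k (τ q) - Y (k + 1) (τ q))
          (fun k => Y k (τ p) - Y (k + 1) (τ p))]
      abel
    have h1 : ∀ k ∈ Finset.range p,
        ‖(Y k (τ q) - Y (k + 1) (τ q)) - (Y k (τ p) - Y (k + 1) (τ p))‖ ≤
          C₂ * (τ q - τ p) ^ γ * (L * M x (τ k) (τ (k + 1))) := by
      intro k hk
      have hkp : k + 1 ≤ p := Finset.mem_range.1 hk
      have hkn : k + 1 ≤ n := hkp.trans (hpq.trans hqn)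
      have hX0 : 0 ≤ (τ q - τ p) ^ γ := Real.rpow_nonneg (sub_nonneg.2 (hτm p q hpq)) γ
      exact (hlip x hx hxr _ _ _ _ _ (hτ0 (k + 1)) (hsol k hkn) (hY (k + 1) hkn) (τ p) (τ q)
        (hτm _ _ hkp) (hτm p q hpq) (hτT q hqn)).trans
        (mul_le_mul_of_nonneg_left (hdiff k p hkp (hpq.trans hqn)) (by positivity))
    have h2 : ∀ k ∈ Finset.Ico p q,
        ‖Y k (τ q) - Y (k + 1) (τ q)‖ ≤ L * M x (τ k) (τ (k + 1)) := fun k hk =>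
      hdiff k q (Finset.mem_Ico.1 hk).2 hqn
    have h3 := norm_add_le_of_le (norm_sum_le_of_le _ h1) (norm_sum_le_of_le _ h2)
    rw [← hsub, ← Finset.mul_sum, ← Finset.mul_sum, ← Finset.mul_sum] at h3
    have hX : 0 ≤ τ q - τ p := sub_nonneg.2 (hτm p q hpq)
    have hX0 : 0 ≤ (τ q - τ p) ^ γ := Real.rpow_nonneg hX γ
    have hS1 : 0 ≤ ∑ k ∈ Finset.Ico p q, M x (τ k) (τ (k + 1)) :=
      Finset.sum_nonneg fun k _ => hM0 k
    have hS2 : 0 ≤ ∑ k ∈ Finset.range p, M x (τ k) (τ (k + 1)) :=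
      Finset.sum_nonneg fun k _ => hM0 k
    rw [abs_of_nonneg hX]
    have h4 : 0 ≤ C₂ * L * ∑ k ∈ Finset.Ico p q, M x (τ k) (τ (k + 1)) := by positivity
    have h5 : 0 ≤ L * ((τ q - τ p) ^ γ * ∑ k ∈ Finset.range p, M x (τ k) (τ (k + 1))) := by
      positivity
    linarith

/-- Constants that exist for every bound on a quantity come from a strictly increasing function of
that quantity. -/
theorem exists_strictMono_ge (c : ℕ → ℝ) (hc : ∀ k, 0 ≤ c k) :
    ∃ C : ℝ → ℝ, StrictMono C ∧ (∀ r, 0 < C r) ∧ ∀ r, c ⌈r⌉₊ ≤ C r := by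
  have hpos : ∀ r : ℝ, 0 ≤ ∑ k ∈ Finset.range (⌈r⌉₊ + 1), c k := fun r =>
    Finset.sum_nonneg fun k _ => hc k
  refine ⟨fun r => Real.exp r + ∑ k ∈ Finset.range (⌈r⌉₊ + 1), c k, ?_, fun r => ?_, fun r => ?_⟩
  · refine Real.exp_strictMono.add_monotone fun r r' h => ?_
    exact Finset.sum_le_sum_of_subset_of_nonneg
      (Finset.range_mono (Nat.add_le_add_right (Nat.ceil_mono h) 1)) fun k _ _ => hc k
  · exact add_pos_of_pos_of_nonneg (Real.exp_pos r) (hpos r)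
  · have := Finset.single_le_sum (f := c) (fun k _ => hc k) (Finset.self_mem_range_succ ⌈r⌉₊)
    have := Real.exp_pos r
    simp only
    linarith

end TaylorODE

theorem proposition4p2 {d l : ℕ} (T : ℝ) (hT : 0 < T) (γ : ℝ) (hγ : 1 / 3 < γ) (hγ' : γ ≤ 1)
    (g : Fin l → TaylorODE.E d → TaylorODE.E d) (hg : ∀ i, TaylorODE.IsC3b (g i)) :
    ∃ C : ℝ → ℝ, StrictMono C ∧ (∀ r, 0 < C r) ∧
      ∀ x : ℝ → TaylorODE.E l, TaylorODE.IsPiecewiseDifferentiable T x →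
        TaylorODE.HasFiniteRoughNorm T γ x →
        -- the flow is well defined
        (∀ s ∈ Set.Icc 0 T, ∀ z : TaylorODE.E d, ∃ y, TaylorODE.IsSolution g x T s z y ∧
          ∀ y', TaylorODE.IsSolution g x T s z y' → Set.EqOn y' y (Set.Icc s T)) ∧
        -- the error bounds
        ∀ (a : TaylorODE.E d) (n : ℕ), 0 < n → ∀ p q : ℕ, p < q → q ≤ n →
          ‖TaylorODE.gridError g x T n a q‖ ≤
            C (TaylorODE.roughNorm T γ x) *
              ∑ k ∈ Finset.range q,
                TaylorODE.M x (TaylorODE.gridPoint T n k) (TaylorODE.gridPoint T n (k + 1)) ∧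
          ‖TaylorODE.gridError g x T n a q - TaylorODE.gridError g x T n a p‖ ≤
            C (TaylorODE.roughNorm T γ x) *
              (∑ k ∈ Finset.Ico p q,
                  TaylorODE.M x (TaylorODE.gridPoint T n k) (TaylorODE.gridPoint T n (k + 1)) +
                |TaylorODE.gridPoint T n q - TaylorODE.gridPoint T n p| ^ γ *
                  ∑ k ∈ Finset.range p,
                    TaylorODE.M x (TaylorODE.gridPoint T n k)
                      (TaylorODE.gridPoint T n (k + 1))) := by
  choose c hc0 hc using fun N : ℕ => TaylorODE.exists_gridError_le hγ hT.le hg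
    (N := N) (Nat.cast_nonneg N)
  obtain ⟨C, hCm, hC0, hcC⟩ := TaylorODE.exists_strictMono_ge c hc0
  refine ⟨C, hCm, hC0, fun x hx hxr => ⟨fun s hs z => ?_, fun a n _ p q hpq hqn => ?_⟩⟩
  · obtain ⟨K, hK, hgK⟩ := TaylorODE.exists_fieldBounds hg
    exact TaylorODE.exists_unique_isSolution hx hgK hK hs.1 hs.2 z
  · have hM : ∀ s t, 0 ≤ TaylorODE.M x s t := fun s t => by rw [TaylorODE.M]; positivity
    have h := hc _ x hx (hxr.roughBound (by linarith) (Nat.le_ceil _)) a n p q hpq.le hqn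
    refine ⟨h.1.trans (mul_le_mul_of_nonneg_right (hcC _) ?_),
      h.2.trans (mul_le_mul_of_nonneg_right (hcC _) ?_)⟩
    · exact Finset.sum_nonneg fun k _ => hM _ _
    · exact add_nonneg (Finset.sum_nonneg fun k _ => hM _ _)
        (mul_nonneg (by positivity) (Finset.sum_nonneg fun k _ => hM _ _))
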